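/- Let $\mathbb H_1=\mathbb R^3$ be the Heisenberg group with coordinates $(x,y,z)$, Lebesgue measure $\lambda$ and generating fields $X_1=\partial_x+\tfrac12 y\,\partial_z$, $X_2=\partial_y-\tfrac12 x\,\partial_z$. Let $N=\big((x^2+y^2)^2+16z^2\big)^{1/4}$ be the Kaplan norm, let $\kappa>2$, $U=N^\kappa$, and $d\mu=e^{-U}d\lambda$ (no normalisation is needed, since the bound below is homogeneous in $\mu$). On $L^2(\mu)$ put $$V_j=X_j-\tfrac12 X_jU\quad(j=1,2),\qquad [V_j,V_l]=[X_j,X_l]-\tfrac12[X_j,X_l]U ,$$ where, for $V$ any of these operators, $Vf=g$ with $f,g\in L^2(\mu)$ is understood in the weak sense: $\int f\,V\varphi\,d\mu=-\int g\,\varphi\,d\mu$ for all $\varphi\in C_c^\infty(\mathbb R^3)$. Let $$\Theta=-\sum_{j}V_j^2-\sum_{j,l}[V_j,V_l]^2\qquad (j,l\in\{1,2\}),$$ that is, the operator on $L^2(\mu)$ associated with the quadratic form $\sum_j\|V_jf\|_2^2+\sum_{j,l}\|[V_j,V_l]f\|_2^2$ on the intersection of the domains of the $V_j$ and the $[V_j,V_l]$,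 and let $\Lambda_1=(1+\Theta)^{1/2}$. Then $\Lambda_1$ is well defined: there is exactly one nonnegative self-adjoint operator $\Lambda_1$ on $L^2(\mu)$ with $\Lambda_1^2=1+\Theta$ (with equality of domains). Moreover, every $f\in L^2(\mu)$ such that $V_lf\in L^2(\mu)$ and $V_jV_lf\in L^2(\mu)$ for all $j,l\in\{1,2\}$ lies in the domain of $\Lambda_1$, and $$\|\Lambda_1 f\|_2^2\le 2\Big(\sum_{j,l=1}^{2}\|V_jV_lf\|_2^2+\|f\|_2^2\Big).$$ -/

import Mathlib

open MeasureTheory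
open scoped ContDiff

noncomputable section

namespace Heisenberg

/-- The underlying manifold of `ℍ₁`, with coordinates `p = (x, y, z)`; Lebesgue measure `volume`
is its Haar measure. -/
abbrev H1 : Type := ℝ × ℝ × ℝ

/-- The generating fields `X₁ = ∂ₓ + (y/2) ∂_z` and `X₂ = ∂_y - (x/2) ∂_z`, given by their
coefficient vectors. -/
def gen : Fin 2 → H1 → H1 :=
  ![fun p => (1, 0, p.2.1 / 2), fun p => (0, 1, -p.1 / 2)]

/-- The fields `X_α`, where `α` is a single index `j` or an ordered pair `(j, l)`:
`X_{(j)} = X_j` and `X_{(j,l)} = [X_j, X_l]`. Longer commutators vanish on `ℍ₁`. -/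
def field : Fin 2 ⊕ (Fin 2 × Fin 2) → H1 → H1
  | Sum.inl j => gen j
  | Sum.inr (j, l) => VectorField.lieBracket ℝ (gen j) (gen l)

/-- The Kaplan norm `N = ((x² + y²)² + 16 z²)^(1/4)`. -/
def kaplanNorm (p : H1) : ℝ :=
  ((p.1 ^ 2 + p.2.1 ^ 2) ^ 2 + 16 * p.2.2 ^ 2) ^ (1 / 4 : ℝ)

/-- The interaction `U = N ^ κ`. -/
def interaction (κ : ℝ) (p : H1) : ℝ := kaplanNorm p ^ κ

/-- `dμ = e^{-U} dλ`. -/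
def mu (κ : ℝ) : Measure H1 :=
  volume.withDensity fun p => ENNReal.ofReal (Real.exp (-interaction κ p))

/-- The Hilbert space `L²(μ)`. -/
abbrev L2 (κ : ℝ) : Type := Lp ℂ 2 (mu κ)

/-- The classical expression `V(X, U) φ = X φ - (1/2) (X U) φ`. -/
def fieldV (κ : ℝ) (X : H1 → H1) (φ : H1 → ℂ) (p : H1) : ℂ :=
  fderiv ℝ φ p (X p) - ((1 / 2 * fderiv ℝ (interaction κ) p (X p) : ℝ) : ℂ) * φ p

/-- `HasV κ X f g`: the function `f ∈ L²(μ)` lies in the domain of `V(X, U)` and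
`V(X, U) f = g ∈ L²(μ)`, in the weak sense given by the antisymmetry
`μ (f V φ) = - μ ((V f) φ)`, tested against all smooth compactly supported `φ`. -/
def HasV (κ : ℝ) (X : H1 → H1) (f g : L2 κ) : Prop :=
  ∀ φ : H1 → ℂ, ContDiff ℝ ∞ φ → HasCompactSupport φ →
    ∫ p, f p * fieldV κ X φ p ∂(mu κ) = -∫ p, g p * φ p ∂(mu κ)

/-- `HasTheta κ f h`: `f` lies in the domain of `Θ = -∑_α V_α²` and `Θ f = h`. Here `Θ` is the
operator on `L²(μ)` of the quadratic form `∑_α ‖V_α f‖²` on `⋂_α dom V_α` (each `V_α` being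
antisymmetric, `(-V_α² f, g) = (V_α f, V_α g)`). -/
def HasTheta (κ : ℝ) (f h : L2 κ) : Prop :=
  ∃ v : Fin 2 ⊕ (Fin 2 × Fin 2) → L2 κ,
    (∀ α, HasV κ (field α) f (v α)) ∧
    ∀ (g : L2 κ) (u : Fin 2 ⊕ (Fin 2 × Fin 2) → L2 κ),
      (∀ α, HasV κ (field α) g (u α)) →
        inner ℂ h g = ∑ α, inner ℂ (v α) (u α)

/-- `S = (1 + Θ)^{1/2}`: the unbounded operator `S` is self-adjoint (hence densely defined) and
nonnegative, and `S ∘ S = 1 + Θ`, including equality of domains. -/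
structure IsLambdaOne (κ : ℝ) (S : L2 κ →ₗ.[ℂ] L2 κ) : Prop where
  selfAdjoint : IsSelfAdjoint S
  nonneg : ∀ f : S.domain, 0 ≤ (inner ℂ (S f) (f : L2 κ)).re
  sq_eq : ∀ f h : L2 κ,
    (∃ (hf : f ∈ S.domain) (hSf : S ⟨f, hf⟩ ∈ S.domain), S ⟨S ⟨f, hf⟩, hSf⟩ = f + h) ↔
      HasTheta κ f h

end Heisenberg

end

/-! Multiplication by $e^{-U/2}$ is an isometry of $L^2(\mu)$ into $L^2(\lambda)$ (`toFlat`) that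
turns each $V$ into the bare left-invariant field $X$ (`hasV_iff_isWeak`), so the estimate is one
about $X_1,X_2$ in $L^2(\lambda)$, independent of $U$.

There, put $v_l=X_lf$, $w_{jl}=X_jX_lf$ and $C=[X_1,X_2]$. As the fields are antisymmetric and $C$
is central, $\|Cf\|^2=\langle Cf,X_1v_2-X_2v_1\rangle=\langle Cv_2,v_1\rangle-\langle
Cv_1,v_2\rangle=2\,\mathrm{Re}\langle w_{12},w_{21}\rangle-2\,\mathrm{Re}\langle
w_{11},w_{22}\rangle$. Adding $\|Cf\|^2=\|w_{12}-w_{21}\|^2$ gives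
$2\|Cf\|^2=\sum\|w_{jl}\|^2-\|w_{11}+w_{22}\|^2$. Moreover $\|v_1\|^2+\|v_2\|^2=-\mathrm{Re}\langle
f,w_{11}+w_{22}\rangle$, and the negative square absorbs this by Cauchy–Schwarz.

The vectors $Cv_l$ need not exist in $L^2$. They are replaced by difference quotients of the unitary
groups of right translations: the group of $C$ at time $s^2$ is the group commutator of those of
$X_1,X_2$ at time $s$ (`tendsto_commutator`, `inner_commutator_self`). `IsWeak.hasGen` identifies
weak derivatives with generators.

For $\Lambda_1$, let $J$ be the inclusion of the form domain with its form norm. Closedness of the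
form makes its domain a Hilbert space, $(1+\Theta)^{-1}=JJ^*$ (`hasTheta_iff`), and $\Lambda_1$ is
the inverse of the bounded root $(JJ^*)^{1/2}$. Its domain contains the form domain, where
$\|\Lambda_1f\|$ is the form norm (`exists_unique_sqrt`). -/

noncomputable section

/-! ### Square roots of operators given by closed forms -/

namespace HilbertForm

open Filter Topology

variable {H : Type*} [NormedAddCommGroup H] [InnerProductSpace ℂ H] [CompleteSpace H]

/-- The unbounded inverse of an everywhere defined operator. -/
def inv (A : H →L[ℂ] H) : H →ₗ.[ℂ] H :=
  (LinearMap.toPMap (A : H →ₗ[ℂ] H) ⊤).inverse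

omit [CompleteSpace H] in
theorem inv_spec {A : H →L[ℂ] H} (hA : Function.Injective A) (x y : H) :
    (∃ hx : x ∈ (inv A).domain, inv A ⟨x, hx⟩ = y) ↔ A y = x := by
  have hk : LinearMap.ker (LinearMap.toPMap (A : H →ₗ[ℂ] H) ⊤).toFun = ⊥ := by
    rw [LinearMap.ker_eq_bot']
    rintro ⟨m, hm⟩ h
    have : A m = A 0 := (show A m = 0 from h).trans (map_zero A).symm
    exact Subtype.ext (hA this)
  have key : (x, y) ∈ (inv A).graph ↔ A y = x := by
    rw [inv, LinearPMap.inverse_graph hk]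
    simp [LinearPMap.mem_graph_iff]
  rw [← key, LinearPMap.mem_graph_iff]
  constructor
  · rintro ⟨hx, h⟩
    exact ⟨⟨x, hx⟩, rfl, h⟩
  · rintro ⟨⟨x', hx'⟩, h1, h2⟩
    simp only at h1 h2
    subst h1
    exact ⟨hx', h2⟩

omit [CompleteSpace H] in
theorem comp_self_spec (S : H →ₗ.[ℂ] H) (x y : H) :
    (∃ (hx : x ∈ S.domain) (hSx : S ⟨x, hx⟩ ∈ S.domain), S ⟨S ⟨x, hx⟩, hSx⟩ = y) ↔
      ∃ m, (∃ hx : x ∈ S.domain, S ⟨x, hx⟩ = m) ∧ ∃ hm : m ∈ S.domain, S ⟨m, hm⟩ = y := by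
  constructor
  · rintro ⟨hx, hSx, h⟩
    exact ⟨_, ⟨hx, rfl⟩, hSx, h⟩
  · rintro ⟨_, ⟨hx, rfl⟩, hm, h⟩
    exact ⟨hx, hm, h⟩

omit [CompleteSpace H] in
theorem graph_ext {S T : H →ₗ.[ℂ] H}
    (h : ∀ x y, (∃ hx : x ∈ S.domain, S ⟨x, hx⟩ = y) ↔ ∃ hx : x ∈ T.domain, T ⟨x, hx⟩ = y) :
    S = T := by
  apply LinearPMap.eq_of_eq_graph
  ext ⟨x, y⟩
  have := h x y
  simp only [LinearPMap.mem_graph_iff, Subtype.exists, exists_and_left, exists_eq_left] at this ⊢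
  exact this

theorem isSelfAdjoint_inv {A : H →L[ℂ] H} (hA : Function.Injective A) (hs : IsSelfAdjoint A) :
    IsSelfAdjoint (inv A) := by
  have hsym : ∀ x y, inner ℂ (A x) y = inner ℂ x (A y) := hs.isSymmetric
  have hdom : ∀ y, A y ∈ (inv A).domain := fun y => ((inv_spec hA (A y) y).2 rfl).1
  have hval : ∀ y, inv A ⟨A y, hdom y⟩ = y := fun y => ((inv_spec hA (A y) y).2 rfl).2
  have hdense : Dense ((inv A).domain : Set H) := by
    rw [Submodule.dense_iff_topologicalClosure_eq_top, Submodule.topologicalClosure_eq_top_iff,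
      Submodule.eq_bot_iff]
    intro z hz
    apply hA
    rw [map_zero]
    refine ext_inner_left ℂ fun v => ?_
    rw [← hsym, inner_zero_right]
    exact Submodule.inner_right_of_mem_orthogonal (hdom v) hz
  rw [LinearPMap.isSelfAdjoint_def]
  have hfa : (inv A).IsFormalAdjoint (inv A) := by
    rintro ⟨x, hx⟩ ⟨y, hy⟩
    obtain ⟨u, hu⟩ : ∃ u, inv A ⟨x, hx⟩ = u := ⟨_, rfl⟩
    obtain ⟨v, hv⟩ : ∃ v, inv A ⟨y, hy⟩ = v := ⟨_, rfl⟩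
    rw [hu, hv]
    have h1 := (inv_spec hA x u).1 ⟨hx, hu⟩
    have h2 := (inv_spec hA y v).1 ⟨hy, hv⟩
    simp only
    rw [← h1, ← h2, hsym]
  refine (LinearPMap.eq_of_le_of_domain_eq (hfa.le_adjoint hdense) ?_).symm
  refine le_antisymm (hfa.le_adjoint hdense).1 fun y hy => ?_
  have h := LinearPMap.adjoint_isFormalAdjoint hdense ⟨y, hy⟩
  -- This exhibits any `y` in the adjoint's domain as a value of `A`, hence in the domain of `inv
  -- A`.
  have : A ((inv A).adjoint ⟨y, hy⟩) = y := by
    refine ext_inner_right ℂ fun v => ?_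
    have := h ⟨A v, hdom v⟩
    rw [hval] at this
    rw [hsym, this]
  exact this ▸ hdom _

variable {K : Type*} [NormedAddCommGroup K] [InnerProductSpace ℂ K] [CompleteSpace K]

/-- The inverse of a self-adjoint nonnegative unbounded operator `S` whose square is the inverse
of a bounded operator `B` is the bounded nonnegative square root of `B`. -/
theorem eq_inv_of_sq {A B : H →L[ℂ] H} (hA : Function.Injective A) (hA0 : 0 ≤ A)
    (hAB : A * A = B) {S : H →ₗ.[ℂ] H} (hS : IsSelfAdjoint S)
    (hS0 : ∀ f : S.domain, 0 ≤ (inner ℂ (S f) (f : H)).re)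
    (hsq : ∀ x y, (∃ (hx : x ∈ S.domain) (hSx : S ⟨x, hx⟩ ∈ S.domain),
      S ⟨S ⟨x, hx⟩, hSx⟩ = y) ↔ B y = x) : S = inv A := by
  have hdense := hS.dense_domain
  have hfa : S.IsFormalAdjoint S := by
    have := LinearPMap.adjoint_isFormalAdjoint hdense
    rwa [LinearPMap.isSelfAdjoint_def.1 hS] at this
  -- If $Sx=0$ then $S^2x=0$, so `hsq` gives $x=B0=0$.
  have hinj : ∀ x : S.domain, S x = 0 → x = 0 := by
    rintro ⟨x, hx⟩ h
    have h0 : S ⟨x, hx⟩ ∈ S.domain := by rw [h]; exact S.domain.zero_mem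
    have : S ⟨S ⟨x, hx⟩, h0⟩ = 0 := by
      have : (⟨S ⟨x, hx⟩, h0⟩ : S.domain) = 0 := Subtype.ext h
      rw [this, LinearPMap.map_zero]
    have := (hsq x 0).1 ⟨hx, h0, this⟩
    rw [map_zero] at this
    exact Subtype.ext this.symm
  have hsurj : ∀ y, ∃ x : S.domain, S x = y := fun y => by
    obtain ⟨hx, hSx, h⟩ := (hsq (B y) y).2 rfl
    exact ⟨_, h⟩
  have hbij : Function.Bijective S.toFun :=
    ⟨(injective_iff_map_eq_zero _).2 hinj, hsurj⟩
  let e := LinearEquiv.ofBijective S.toFun hbij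
  let C₀ : H →ₗ[ℂ] H := S.domain.subtype ∘ₗ (e.symm : H →ₗ[ℂ] S.domain)
  have hSe : ∀ y, S (e.symm y) = y := fun y => e.apply_symm_apply y
  have hC₀ : C₀.IsSymmetric := fun x y => by
    have := hfa (e.symm x) (e.symm y)
    rw [hSe, hSe] at this
    exact this.symm
  -- Hellinger–Toeplitz: a symmetric operator defined everywhere is bounded.
  let C : H →L[ℂ] H := ⟨C₀, hC₀.continuous⟩
  have hC : ∀ y, C y = e.symm y := fun y => rfl
  have hCspec : ∀ x y, (∃ hx : x ∈ S.domain, S ⟨x, hx⟩ = y) ↔ C y = x := by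
    intro x y
    constructor
    · rintro ⟨hx, rfl⟩
      rw [hC]
      exact congrArg Subtype.val (e.symm_apply_apply ⟨x, hx⟩)
    · rintro rfl
      exact ⟨(e.symm y).2, hSe y⟩
  have hC0 : 0 ≤ C := by
    rw [ContinuousLinearMap.nonneg_iff_isPositive, ContinuousLinearMap.isPositive_def']
    refine ⟨ContinuousLinearMap.isSelfAdjoint_iff_isSymmetric.2 hC₀, fun x => ?_⟩
    have := hS0 (e.symm x)
    rw [hSe] at this
    rw [ContinuousLinearMap.reApplyInnerSelf_apply, hC, inner_re_symm]
    exact this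
  have hCC : C * C = B := by
    ext y
    refine ((hsq (C (C y)) y).1 ?_).symm
    exact (comp_self_spec _ _ _).2 ⟨C y, (hCspec _ _).2 rfl, (hCspec _ _).2 rfl⟩
  -- Uniqueness of $S$ is thus uniqueness of the bounded nonnegative square root.
  have hAC : A = C := (CFC.sqrt_unique hAB hA0).symm.trans (CFC.sqrt_unique hCC hC0)
  refine graph_ext fun x y => ?_
  rw [hCspec, inv_spec hA, hAC]

/-- The square root of the operator `(J J*)⁻¹` of a closed form, whose form domain is the range of
an injection `J` with dense range. -/
theorem exists_unique_sqrt (J : K →L[ℂ] H) (hJ : Function.Injective J) (hd : DenseRange J) :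
    ∃ Λ : H →ₗ.[ℂ] H, (IsSelfAdjoint Λ ∧ (∀ f : Λ.domain, 0 ≤ (inner ℂ (Λ f) (f : H)).re) ∧
      ∀ x y, (∃ (hx : x ∈ Λ.domain) (hSx : Λ ⟨x, hx⟩ ∈ Λ.domain),
        Λ ⟨Λ ⟨x, hx⟩, hSx⟩ = y) ↔ J (J.adjoint y) = x) ∧
      (∀ S : H →ₗ.[ℂ] H, IsSelfAdjoint S → (∀ f : S.domain, 0 ≤ (inner ℂ (S f) (f : H)).re) →
        (∀ x y, (∃ (hx : x ∈ S.domain) (hSx : S ⟨x, hx⟩ ∈ S.domain),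
          S ⟨S ⟨x, hx⟩, hSx⟩ = y) ↔ J (J.adjoint y) = x) → S = Λ) ∧
      ∀ k, ∃ hk : J k ∈ Λ.domain, ‖Λ ⟨J k, hk⟩‖ = ‖k‖ := by
  set B : H →L[ℂ] H := J ∘L J.adjoint with hB
  have hB0 : 0 ≤ B := by
    rw [ContinuousLinearMap.nonneg_iff_isPositive]
    exact ContinuousLinearMap.isPositive_self_comp_adjoint J
  have hadj : Function.Injective J.adjoint := by
    rw [injective_iff_map_eq_zero]
    intro x hx
    refine hd.eq_zero_of_inner_left ℂ fun k => ?_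
    rw [← ContinuousLinearMap.adjoint_inner_left, hx, inner_zero_left]
  have hBinj : Function.Injective B := hJ.comp hadj
  set A := CFC.sqrt B with hAdef
  have hA0 : 0 ≤ A := CFC.sqrt_nonneg B
  have hAA : A * A = B := CFC.sqrt_mul_sqrt_self B hB0
  have hAA' : ∀ x, A (A x) = B x := fun x => by rw [← hAA]; rfl
  have hA : Function.Injective A := fun x y h => hBinj (by rw [← hAA', h, hAA'])
  have hAs : IsSelfAdjoint A := IsSelfAdjoint.of_nonneg hA0
  have hsym : ∀ x y, inner ℂ (A x) y = inner ℂ x (A y) := hAs.isSymmetric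
  have hnorm : ∀ h, ‖A h‖ = ‖J.adjoint h‖ := fun h => by
    rw [@norm_eq_sqrt_re_inner ℂ, @norm_eq_sqrt_re_inner ℂ, hsym, hAA', hB,
      ContinuousLinearMap.comp_apply, ContinuousLinearMap.adjoint_inner_left]
  have hspec := inv_spec hA
  refine ⟨inv A, ⟨isSelfAdjoint_inv hA hAs, ?_, ?_⟩, ?_, ?_⟩
  · rintro ⟨x, hx⟩
    have h := (hspec x _).1 ⟨hx, rfl⟩
    have hpos := (ContinuousLinearMap.nonneg_iff_isPositive A).1 hA0
    have := hpos.re_inner_nonneg_right (inv A ⟨x, hx⟩)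
    rw [h] at this
    exact this
  · intro x y
    rw [← ContinuousLinearMap.comp_apply, ← hB, ← hAA', comp_self_spec]
    simp only [hspec]
    exact ⟨fun ⟨m, h1, h2⟩ => by rw [h2, h1], fun h => ⟨_, h, rfl⟩⟩
  · intro S hS hS0 hsq
    exact eq_inv_of_sq hA hA0 hAA hS hS0 hsq
  · intro k
    -- By `hnorm`, $J^*h\mapsto Ah$ is isometric. Extending it to the closure of the range of $J^*$,
    -- which is all of $K$, gives $y$ with $Ay=Jk$ and $\|y\|=\|k\|$.
    have hdr : DenseRange J.adjoint := by
      have : Dense ((LinearMap.range (J.adjoint : H →ₗ[ℂ] K) : Submodule ℂ K) : Set K) := by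
        rw [Submodule.dense_iff_topologicalClosure_eq_top,
          Submodule.topologicalClosure_eq_top_iff, Submodule.eq_bot_iff]
        intro z hz
        apply hJ
        rw [map_zero]
        refine ext_inner_left ℂ fun v => ?_
        rw [← ContinuousLinearMap.adjoint_inner_left, inner_zero_right]
        exact Submodule.inner_right_of_mem_orthogonal (LinearMap.mem_range_self _ v) hz
      exact this
    obtain ⟨u, hu, hlim⟩ := mem_closure_iff_seq_limit.1 (hdr k)
    choose h hh using hu
    have hc : CauchySeq fun n => A (h n) := by
      have hc' := hlim.cauchySeq
      rw [Metric.cauchySeq_iff'] at hc' ⊢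
      intro ε hε
      obtain ⟨N, hN⟩ := hc' ε hε
      refine ⟨N, fun n hn => ?_⟩
      have := hN n hn
      rw [dist_eq_norm] at this ⊢
      rwa [← map_sub, hnorm, map_sub, hh, hh]
    obtain ⟨y, hy⟩ := cauchySeq_tendsto_of_complete hc
    have hny : ‖y‖ = ‖k‖ := by
      refine tendsto_nhds_unique hy.norm ?_
      simp only [hnorm, hh]
      exact hlim.norm
    have hAy : A y = J k := by
      refine tendsto_nhds_unique ((A.continuous.tendsto y).comp hy) ?_
      have : (A ∘ fun n => A (h n)) = fun n => J (u n) := by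
        funext n
        simp only [Function.comp_apply, hAA', hB, ContinuousLinearMap.comp_apply, hh]
      rw [this]
      exact (J.continuous.tendsto k).comp hlim
    obtain ⟨h1, h2⟩ := (hspec (J k) y).2 hAy
    exact ⟨h1, by rw [h2, hny]⟩

end HilbertForm
end

noncomputable section

/-! ### Commutators of unitary groups and the abstract estimate -/

namespace UnitaryGroup

open Filter Topology

variable {H : Type*} [NormedAddCommGroup H] [InnerProductSpace ℂ H]

/-- Strongly continuous one-parameter unitary groups. -/
structure IsUnitaryGroup (u : ℝ → H →L[ℂ] H) : Prop where
  zero : ∀ x, u 0 x = x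
  add : ∀ s t x, u (s + t) x = u s (u t x)
  inner : ∀ s x y, inner ℂ (u s x) y = inner ℂ x (u (-s) y)
  cont : ∀ x, Continuous fun s => u s x

/-- `x` lies in the domain of the infinitesimal generator of `u`, which maps it to `y`. -/
def HasGen (u : ℝ → H →L[ℂ] H) (x y : H) : Prop :=
  Tendsto (fun s : ℝ => (s : ℂ)⁻¹ • (u s x - x)) (𝓝[≠] 0) (𝓝 y)

variable {a b c : ℝ → H →L[ℂ] H}

namespace IsUnitaryGroup

theorem neg_apply (ha : IsUnitaryGroup a) (s : ℝ) (x : H) : a s (a (-s) x) = x := by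
  rw [← ha.add, add_neg_cancel, ha.zero]

theorem norm_apply (ha : IsUnitaryGroup a) (s : ℝ) (x : H) : ‖a s x‖ = ‖x‖ := by
  have : a (-s) (a s x) = x := by simpa using ha.neg_apply (-s) x
  rw [@norm_eq_sqrt_re_inner ℂ, @norm_eq_sqrt_re_inner ℂ, ha.inner, this]

theorem tendsto_apply (ha : IsUnitaryGroup a) {l : Filter ℝ} {s : ℝ → ℝ} {z : ℝ → H} {z₀ : H}
    (hs : Tendsto s l (𝓝 0)) (hz : Tendsto z l (𝓝 z₀)) :
    Tendsto (fun d => a (s d) (z d)) l (𝓝 z₀) := by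
  have h1 : Tendsto (fun d => a (s d) (z d - z₀)) l (𝓝 0) := by
    rw [tendsto_zero_iff_norm_tendsto_zero]
    simp only [ha.norm_apply]
    rw [← tendsto_zero_iff_norm_tendsto_zero]
    simpa using hz.sub_const z₀
  have h2 : Tendsto (fun d => a (s d) z₀) l (𝓝 z₀) := by
    have := ((ha.cont z₀).tendsto 0).comp hs
    rwa [ha.zero] at this
  have := h1.add h2
  rw [zero_add] at this
  refine this.congr fun d => ?_
  rw [map_sub, sub_add_cancel]

end IsUnitaryGroup

theorem tendsto_neg_punctured : Tendsto (fun s : ℝ => -s) (𝓝[≠] 0) (𝓝[≠] 0) := by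
  refine tendsto_nhdsWithin_of_tendsto_nhds_of_eventually_within _ ?_ ?_
  · have : Tendsto (fun s : ℝ => -s) (𝓝 0) (𝓝 0) := by simpa using (continuous_neg (G := ℝ)).tendsto 0
    exact this.mono_left nhdsWithin_le_nhds
  · filter_upwards [self_mem_nhdsWithin] with s hs
    simpa using hs

theorem tendsto_sq_punctured : Tendsto (fun s : ℝ => s ^ 2) (𝓝[≠] 0) (𝓝[≠] 0) := by
  refine tendsto_nhdsWithin_of_tendsto_nhds_of_eventually_within _ ?_ ?_
  · have : Tendsto (fun s : ℝ => s ^ 2) (𝓝 0) (𝓝 0) := by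
      simpa using (continuous_pow (M := ℝ) 2).tendsto 0
    exact this.mono_left nhdsWithin_le_nhds
  · filter_upwards [self_mem_nhdsWithin] with s hs
    simpa using hs

theorem HasGen.neg {x y : H} (h : HasGen a x y) :
    Tendsto (fun s : ℝ => (s : ℂ)⁻¹ • (a (-s) x - x)) (𝓝[≠] 0) (𝓝 (-y)) := by
  have := (Tendsto.comp h tendsto_neg_punctured).neg
  refine this.congr fun s => ?_
  simp only [Function.comp_apply, Complex.ofReal_neg, inv_neg, neg_smul, neg_neg]

theorem HasGen.inner_skew (ha : IsUnitaryGroup a) {x x' y y' : H} (hx : HasGen a x x')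
    (hy : HasGen a y y') : inner ℂ x' y = -inner ℂ x y' := by
  have h1 : Tendsto (fun s : ℝ => inner ℂ ((s : ℂ)⁻¹ • (a s x - x)) y) (𝓝[≠] 0)
      (𝓝 (inner ℂ x' y)) := Tendsto.inner hx tendsto_const_nhds
  have h2 : Tendsto (fun s : ℝ => inner ℂ x ((s : ℂ)⁻¹ • (a (-s) y - y))) (𝓝[≠] 0)
      (𝓝 (inner ℂ x (-y'))) := Tendsto.inner tendsto_const_nhds hy.neg
  rw [inner_neg_right] at h2
  refine tendsto_nhds_unique h1 (h2.congr fun s => ?_)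
  rw [inner_smul_left, inner_smul_right, inner_sub_left, inner_sub_right, ha.inner, map_inv₀,
    Complex.conj_ofReal]

theorem HasGen.map {x x' : H} (hx : HasGen a x x') (L : H →L[ℂ] H)
    (hL : ∀ s z, L (a s z) = a s (L z)) : HasGen a (L x) (L x') := by
  refine ((L.continuous.tendsto x').comp hx).congr fun s => ?_
  rw [Function.comp_apply, map_smul, map_sub, hL]

section Commutator

variable (ha : IsUnitaryGroup a) (hb : IsUnitaryGroup b) (hc : IsUnitaryGroup c)
  (hab : ∀ s t x, a s (b t x) = c (s * t) (b t (a s x)))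

include ha hb hab in
/-- On the common domain of the generators the group commutator is trivial to first order. -/
theorem tendsto_commutator_zero {v p q : H} (hp : HasGen a v p) (hq : HasGen b v q) :
    Tendsto (fun s : ℝ => (s : ℂ)⁻¹ • (c (s ^ 2) v - v)) (𝓝[≠] 0) (𝓝 0) := by
  have hid : Tendsto (fun s : ℝ => s) (𝓝[≠] 0) (𝓝 0) := tendsto_id.mono_left nhdsWithin_le_nhds
  have hneg : Tendsto (fun s : ℝ => -s) (𝓝[≠] 0) (𝓝 0) :=
    tendsto_neg_punctured.mono_right nhdsWithin_le_nhds
  -- The difference $a_sb_sa_{-s}b_{-s}v-v$ telescopes into four increments carried by unitaries;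
  -- their quotients by $s$ tend to $-q,-p,q,p$.
  have h4 := ha.tendsto_apply hid (hb.tendsto_apply hid (ha.tendsto_apply hneg hq.neg))
  have h3 := ha.tendsto_apply hid (hb.tendsto_apply hid hp.neg)
  have h2 := ha.tendsto_apply hid hq
  have := ((h4.add h3).add h2).add hp
  rw [show -q + -p + q + p = 0 by abel] at this
  refine this.congr fun s => ?_
  have key : c (s ^ 2) v = a s (b s (a (-s) (b (-s) v))) := by
    rw [hab, ha.neg_apply, hb.neg_apply, sq]
  rw [key]
  simp only [map_smul, map_sub, ← smul_add]
  congr 1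
  abel

-- A weak second-order form of $\langle Cv_1,v_2\rangle$ that does not require $v_1$ in the domain
-- of $C$. Moving the groups across the inner product leaves products of two first-order quotients.
-- The remaining error pairs the quotient $s^{-1}(c_{s^2}v_1-v_1)\to0$ with a convergent vector.
include ha hb hc hab in
theorem tendsto_commutator {v₁ v₂ w₁₁ w₁₂ w₂₁ w₂₂ : H} (h11 : HasGen a v₁ w₁₁)
    (h12 : HasGen a v₂ w₁₂) (h21 : HasGen b v₁ w₂₁) (h22 : HasGen b v₂ w₂₂) :
    Tendsto (fun s : ℝ => inner ℂ (((s ^ 2 : ℝ) : ℂ)⁻¹ • (c (s ^ 2) v₁ - v₁)) v₂) (𝓝[≠] 0)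
      (𝓝 (inner ℂ w₁₁ w₂₂ - inner ℂ w₂₁ w₁₂)) := by
  have hid : Tendsto (fun s : ℝ => s) (𝓝[≠] 0) (𝓝 0) := tendsto_id.mono_left nhdsWithin_le_nhds
  have t1 := Tendsto.inner (𝕜 := ℂ) h11 h22
  have t2 := Tendsto.inner (𝕜 := ℂ) h21.neg h12.neg
  have t3 := Tendsto.inner (𝕜 := ℂ) (tendsto_commutator_zero ha hb hab h11 h21)
    ((hb.tendsto_apply hid h12.neg).add h22)
  have t := (t1.sub t2).sub t3
  rw [inner_zero_left, sub_zero, inner_neg_neg] at t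
  refine t.congr fun s => ?_
  have key : a (-s) (b s v₂) = c (-(s ^ 2)) (b s (a (-s) v₂)) := by
    rw [hab, neg_mul, sq]
  have e1 : inner ℂ v₁ (a (-s) (b s v₂)) = inner ℂ (c (s ^ 2) v₁) (b s (a (-s) v₂)) := by
    rw [key, hc.inner]
  have e2 : inner ℂ (a s v₁) (b s v₂) = inner ℂ v₁ (a (-s) (b s v₂)) := ha.inner _ _ _
  have e3 : inner ℂ (a s v₁) v₂ = inner ℂ v₁ (a (-s) v₂) := ha.inner _ _ _
  have e4 : inner ℂ (b (-s) v₁) (a (-s) v₂) = inner ℂ v₁ (b s (a (-s) v₂)) := by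
    rw [hb.inner, neg_neg]
  have e5 : inner ℂ (b (-s) v₁) v₂ = inner ℂ v₁ (b s v₂) := by
    rw [hb.inner, neg_neg]
  simp only [map_smul, map_sub, ← smul_add, inner_smul_left, inner_smul_right, inner_sub_left,
    inner_sub_right, inner_add_right, e2, e1, e3, e4, e5, map_inv₀, Complex.conj_ofReal]
  push_cast
  ring

-- The rigorous version of $\langle Cf,X_1v_2-X_2v_1\rangle=\langle Cv_2,v_1\rangle-\langle
-- Cv_1,v_2\rangle$, with $C$ approximated by bounded quotients.
include ha hb hc hab in
theorem inner_commutator_self (hca : ∀ r s x, c r (a s x) = a s (c r x))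
    (hcb : ∀ r s x, c r (b s x) = b s (c r x)) {f v₁ v₂ w₁₁ w₁₂ w₂₁ w₂₂ : H}
    (hf1 : HasGen a f v₁) (hf2 : HasGen b f v₂) (h11 : HasGen a v₁ w₁₁)
    (h12 : HasGen a v₂ w₁₂) (h21 : HasGen b v₁ w₂₁) (h22 : HasGen b v₂ w₂₂)
    (hfc : HasGen c f (w₁₂ - w₂₁)) :
    (inner ℂ (w₁₂ - w₂₁) (w₁₂ - w₂₁) : ℂ) = inner ℂ w₁₂ w₂₁ + inner ℂ w₂₁ w₁₂
      - inner ℂ w₁₁ w₂₂ - inner ℂ w₂₂ w₁₁ := by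
  have t1 := tendsto_commutator ha hb hc hab h11 h12 h21 h22
  have t2 := tendsto_commutator ha hb hc hab h12 h11 h22 h21
  have t3 : Tendsto (fun s : ℝ => inner ℂ (((s ^ 2 : ℝ) : ℂ)⁻¹ • (c (s ^ 2) f - f)) (w₁₂ - w₂₁))
      (𝓝[≠] 0) (𝓝 (inner ℂ (w₁₂ - w₂₁) (w₁₂ - w₂₁))) :=
    Tendsto.inner (Tendsto.comp hfc tendsto_sq_punctured) tendsto_const_nhds
  have t4 := t2.sub t1
  have := tendsto_nhds_unique t3 (t4.congr fun s => ?_)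
  · rw [this]
    ring
  -- `L` commutes with both groups, so it maps $f$ into the domains of both generators, and
  -- antisymmetry applies to $Lf$.
  · let L : H →L[ℂ] H := ((s ^ 2 : ℝ) : ℂ)⁻¹ • (c (s ^ 2) - ContinuousLinearMap.id ℂ H)
    have hLa : ∀ s z, L (a s z) = a s (L z) := fun s z => by simp [L, hca]
    have hLb : ∀ s z, L (b s z) = b s (L z) := fun s z => by simp [L, hcb]
    have e1 := (hf1.map L hLa).inner_skew ha h12
    have e2 := (hf2.map L hLb).inner_skew hb h21
    change inner ℂ (L v₂) v₁ - inner ℂ (L v₁) v₂ = inner ℂ (L f) (w₁₂ - w₂₁)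
    rw [e1, e2, inner_sub_right]
    ring

include ha hb hc hab in
theorem sq_norm_le_of_hasGen (hca : ∀ r s x, c r (a s x) = a s (c r x))
    (hcb : ∀ r s x, c r (b s x) = b s (c r x)) {f v₁ v₂ w₁₁ w₁₂ w₂₁ w₂₂ : H}
    (hf1 : HasGen a f v₁) (hf2 : HasGen b f v₂) (h11 : HasGen a v₁ w₁₁)
    (h12 : HasGen a v₂ w₁₂) (h21 : HasGen b v₁ w₂₁) (h22 : HasGen b v₂ w₂₂)
    (hfc : HasGen c f (w₁₂ - w₂₁)) :
    ‖f‖ ^ 2 + (‖v₁‖ ^ 2 + ‖v₂‖ ^ 2) + 2 * ‖w₁₂ - w₂₁‖ ^ 2 ≤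
      2 * ((‖w₁₁‖ ^ 2 + ‖w₁₂‖ ^ 2 + (‖w₂₁‖ ^ 2 + ‖w₂₂‖ ^ 2)) + ‖f‖ ^ 2) := by
  have key := congrArg Complex.re
    (inner_commutator_self ha hb hc hab hca hcb hf1 hf2 h11 h12 h21 h22 hfc)
  have hv := congrArg Complex.re (hf1.inner_skew ha h11)
  have hv' := congrArg Complex.re (hf2.inner_skew hb h22)
  have hcs : -(inner ℂ f (w₁₁ + w₂₂) : ℂ).re ≤ ‖f‖ * ‖w₁₁ + w₂₂‖ :=
    (neg_le_abs _).trans ((Complex.abs_re_le_norm _).trans (norm_inner_le_norm _ _))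
  have hn : ∀ x : H, (inner ℂ x x : ℂ).re = ‖x‖ ^ 2 := fun x => inner_self_eq_norm_sq (𝕜 := ℂ) x
  have s1 : (inner ℂ w₂₂ w₁₁ : ℂ).re = (inner ℂ w₁₁ w₂₂ : ℂ).re := inner_re_symm (𝕜 := ℂ) _ _
  have s2 : (inner ℂ w₂₁ w₁₂ : ℂ).re = (inner ℂ w₁₂ w₂₁ : ℂ).re := inner_re_symm (𝕜 := ℂ) _ _
  have n1 : ‖w₁₁ + w₂₂‖ ^ 2 = ‖w₁₁‖ ^ 2 + 2 * (inner ℂ w₁₁ w₂₂ : ℂ).re + ‖w₂₂‖ ^ 2 :=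
    norm_add_sq (𝕜 := ℂ) _ _
  have n2 : ‖w₁₂ - w₂₁‖ ^ 2 = ‖w₁₂‖ ^ 2 - 2 * (inner ℂ w₁₂ w₂₁ : ℂ).re + ‖w₂₁‖ ^ 2 :=
    norm_sub_sq (𝕜 := ℂ) _ _
  simp only [Complex.add_re, Complex.sub_re, Complex.neg_re, hn, inner_add_right] at key hv hv' hcs
  -- With $t=\|w_{11}+w_{22}\|$ the left side is at most $\|f\|^2+\|f\|t+\sum\|w_{jl}\|^2-t^2$, and
  -- $\|f\|t\le\frac12(\|f\|^2+t^2)$.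
  nlinarith [sq_nonneg (‖f‖ - ‖w₁₁ + w₂₂‖), sq_nonneg ‖w₁₁ + w₂₂‖]

end Commutator

end UnitaryGroup
end

noncomputable section

namespace Heisenberg

open Filter Topology
open scoped Convolution Pointwise

instance : (volume : Measure H1).IsAddHaarMeasure :=
  have : (volume : Measure (ℝ × ℝ)).IsAddHaarMeasure :=
    Measure.prod.instIsAddHaarMeasure (volume : Measure ℝ) (volume : Measure ℝ)
  Measure.prod.instIsAddHaarMeasure (volume : Measure ℝ) (volume : Measure (ℝ × ℝ))

/-! ### Mollification, from smooth to $C^1$ test functions -/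

section Mollifier

/-- Bump functions on `ℍ₁` whose supports shrink to the origin. -/
def bump (n : ℕ) : ContDiffBump (0 : H1) where
  rIn := 1 / (2 * (n + 1))
  rOut := 1 / (n + 1)
  rIn_pos := by positivity
  rIn_lt_rOut := by
    apply one_div_lt_one_div_of_lt <;> linarith [(Nat.cast_nonneg n : (0 : ℝ) ≤ n)]

theorem bump_rOut_le (n : ℕ) : (bump n).rOut ≤ 1 := by
  change 1 / ((n : ℝ) + 1) ≤ 1
  rw [div_le_one (by positivity)]
  linarith [(Nat.cast_nonneg n : (0 : ℝ) ≤ n)]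

theorem tendsto_bump_rOut : Tendsto (fun n => (bump n).rOut) atTop (𝓝 0) :=
  tendsto_one_div_add_atTop_nhds_zero_nat

variable {E : Type*} [NormedAddCommGroup E] [NormedSpace ℝ E] [CompleteSpace E]

/-- The convolution of `g` with `bump n`, normalised. -/
def mollify (n : ℕ) (g : H1 → E) : H1 → E :=
  (bump n).normed volume ⋆[ContinuousLinearMap.lsmul ℝ ℝ, volume] g

theorem tendsto_mollify {g : H1 → E} (hg : Continuous g) (x : H1) :
    Tendsto (fun n => mollify n g x) atTop (𝓝 (g x)) :=
  ContDiffBump.convolution_tendsto_right_of_continuous tendsto_bump_rOut hg x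

theorem norm_mollify_le {g : H1 → E} (hg : Continuous g) {M : ℝ} (hM : ∀ x, ‖g x‖ ≤ M) (n : ℕ)
    (x : H1) : ‖mollify n g x‖ ≤ 3 * M := by
  have h : dist (mollify n g x) (g x) ≤ 2 * M :=
    ContDiffBump.dist_normed_convolution_le hg.aestronglyMeasurable fun y _ => by
      rw [dist_eq_norm]
      exact (norm_sub_le _ _).trans (by linarith [hM x, hM y])
  rw [dist_eq_norm] at h
  have := norm_le_norm_add_norm_sub' (mollify n g x) (g x)
  linarith [hM x]

omit [CompleteSpace E] in
theorem support_mollify_subset (n : ℕ) (g : H1 → E) :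
    Function.support (mollify n g) ⊆ Metric.closedBall 0 1 + tsupport g := by
  refine (support_convolution_subset _).trans (Set.add_subset_add ?_ (subset_tsupport g))
  rw [ContDiffBump.support_normed_eq]
  exact Metric.ball_subset_closedBall.trans (Metric.closedBall_subset_closedBall (bump_rOut_le n))

omit [CompleteSpace E] in
theorem contDiff_mollify (n : ℕ) {g : H1 → E} (hg : Continuous g) :
    ContDiff ℝ ∞ (mollify n g) :=
  HasCompactSupport.contDiff_convolution_left _ (bump n).hasCompactSupport_normed
    (bump n).contDiff_normed hg.locallyIntegrable

omit [CompleteSpace E] in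
theorem hasCompactSupport_mollify (n : ℕ) {g : H1 → E} (hg : HasCompactSupport g) :
    HasCompactSupport (mollify n g) :=
  HasCompactSupport.of_support_subset_isCompact ((isCompact_closedBall 0 1).add hg)
    (support_mollify_subset n g)

omit [CompleteSpace E] in
theorem fderiv_mollify (n : ℕ) {g : H1 → E} (hg : ContDiff ℝ 1 g) (hc : HasCompactSupport g)
    (x : H1) : fderiv ℝ (mollify n g) x = mollify n (fderiv ℝ g) x :=
  (HasCompactSupport.hasFDerivAt_convolution_right (ContinuousLinearMap.lsmul ℝ ℝ) hc
    (bump n).continuous_normed.locallyIntegrable hg x).fderiv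

end Mollifier

/-- First order identities tested by smooth functions hold for continuously differentiable tests. -/
theorem integral_eq_zero_of_smooth_tests {A B : H1 → ℂ} {X : H1 → H1} (hA : LocallyIntegrable A)
    (hB : LocallyIntegrable B) (hX : Continuous X)
    (h : ∀ φ : H1 → ℂ, ContDiff ℝ ∞ φ → HasCompactSupport φ →
      ∫ p, (A p * fderiv ℝ φ p (X p) + B p * φ p) = 0)
    {φ : H1 → ℂ} (hφ : ContDiff ℝ 1 φ) (hc : HasCompactSupport φ) :
    ∫ p, (A p * fderiv ℝ φ p (X p) + B p * φ p) = 0 := by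
  have hdφ : Continuous (fderiv ℝ φ) := hφ.continuous_fderiv one_ne_zero
  obtain ⟨M, hM⟩ := hc.exists_bound_of_continuous hφ.continuous
  obtain ⟨M', hM'⟩ := (hc.fderiv ℝ).exists_bound_of_continuous hdφ
  -- All bumps have radius at most 1, so this one compact set contains the support of every
  -- mollified test.
  set K : Set H1 := Metric.closedBall 0 1 + tsupport φ with hK
  have hKc : IsCompact K := (isCompact_closedBall 0 1).add hc
  obtain ⟨R, hR⟩ := hKc.exists_bound_of_continuousOn hX.continuousOn
  have hM'0 : 0 ≤ M' := (norm_nonneg _).trans (hM' 0)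
  let bd : H1 → ℝ := K.indicator fun p => ‖A p‖ * (3 * M' * R) + ‖B p‖ * (3 * M)
  have hbd : Integrable bd := by
    rw [integrable_indicator_iff hKc.measurableSet]
    exact ((hA.integrableOn_isCompact hKc).norm.mul_const _).add
      ((hB.integrableOn_isCompact hKc).norm.mul_const _)
  have key := tendsto_integral_of_dominated_convergence (F := fun n p =>
    A p * fderiv ℝ (mollify n φ) p (X p) + B p * mollify n φ p)
    (f := fun p => A p * fderiv ℝ φ p (X p) + B p * φ p) bd ?_ hbd ?_ ?_
  · have hz : ∀ n, ∫ p, (A p * fderiv ℝ (mollify n φ) p (X p) + B p * mollify n φ p) = 0 :=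
      fun n => h _ (contDiff_mollify n hφ.continuous) (hasCompactSupport_mollify n hc)
    simp only [hz] at key
    exact (tendsto_nhds_unique key tendsto_const_nhds)
  · intro n
    have hs := contDiff_mollify n hφ.continuous
    exact (hA.aestronglyMeasurable.mul
      ((hs.continuous_fderiv (by simp)).clm_apply hX).aestronglyMeasurable).add
      (hB.aestronglyMeasurable.mul hs.continuous.aestronglyMeasurable)
  · refine fun n => ae_of_all _ fun p => ?_
    rw [fderiv_mollify n hφ hc]
    by_cases hp : p ∈ K
    · simp only [bd, Set.indicator_of_mem hp]
      have h1 := norm_mollify_le hφ.continuous hM n p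
      have h2 := norm_mollify_le hdφ hM' n p
      have h3 : ‖mollify n (fderiv ℝ φ) p (X p)‖ ≤ 3 * M' * R :=
        (ContinuousLinearMap.le_opNorm _ _).trans
          (mul_le_mul h2 (hR p hp) (norm_nonneg _) (by positivity))
      refine (norm_add_le _ _).trans (add_le_add ?_ ?_)
      · exact (norm_mul_le _ _).trans (mul_le_mul_of_nonneg_left h3 (norm_nonneg _))
      · exact (norm_mul_le _ _).trans (mul_le_mul_of_nonneg_left h1 (norm_nonneg _))
    · have h1 : mollify n φ p = 0 := by
        by_contra hne
        exact hp (support_mollify_subset n φ hne)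
      have h2 : mollify n (fderiv ℝ φ) p = 0 := by
        by_contra hne
        have h3 := support_mollify_subset n (fderiv ℝ φ) (Function.mem_support.2 hne)
        have h4 : tsupport (fderiv ℝ φ) ⊆ tsupport φ := tsupport_fderiv_subset ℝ
        exact hp (Set.add_subset_add_left h4 h3)
      simp [bd, Set.indicator_of_notMem hp, h1, h2]
  · refine ae_of_all _ fun p => ?_
    have t : Tendsto (fun n => mollify n (fderiv ℝ φ) p (X p)) atTop (𝓝 (fderiv ℝ φ p (X p))) :=
      ((ContinuousLinearMap.apply ℝ ℂ (X p)).continuous.tendsto _).comp (tendsto_mollify hdφ p)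
    refine ((t.const_mul (A p)).add ((tendsto_mollify hφ.continuous p).const_mul (B p))).congr
      fun n => ?_
    rw [fderiv_mollify n hφ hc]

/-! ### Left-invariant fields and right translations -/

/-- The left-invariant field with value `a` at the origin. -/
def leftInv (a p : H1) : H1 :=
  (a.1, a.2.1, a.2.2 + (a.1 * p.2.1 - a.2.1 * p.1) / 2)

theorem contDiff_leftInv (a : H1) {n : WithTop ℕ∞} : ContDiff ℝ n (leftInv a) := by
  unfold leftInv
  fun_prop

/-- Left-invariant fields are divergence-free: a constant field plus a multiple of $\partial_z$
whose coefficient does not depend on $z$. -/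
theorem integral_fderiv_leftInv (a : H1) {χ : H1 → ℂ} (hχ : ContDiff ℝ 1 χ)
    (hc : HasCompactSupport χ) : ∫ p, fderiv ℝ χ p (leftInv a p) = 0 := by
  have hd : Continuous (fderiv ℝ χ) := hχ.continuous_fderiv one_ne_zero
  have hcd := hc.fderiv ℝ
  have key : ∀ (f : H1 → ℝ) (v : H1), ContDiff ℝ 1 f → (∀ p, fderiv ℝ f p v = 0) →
      Integrable (fun p => f p • fderiv ℝ χ p v) ∧ ∫ p, f p • fderiv ℝ χ p v = 0 := by
    intro f v hf h0
    have hi : Integrable (fun p => f p • fderiv ℝ χ p v) := by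
      have hcv : HasCompactSupport fun p => fderiv ℝ χ p v :=
        hcd.comp_left (g := fun L : H1 →L[ℝ] ℂ => L v) rfl
      exact Continuous.integrable_of_hasCompactSupport
        (hf.continuous.smul (hd.clm_apply continuous_const)) (hcv.smul_left (f := f))
    refine ⟨hi, ?_⟩
    rw [integral_smul_fderiv_eq_neg_fderiv_smul_of_integrable]
    · simp [h0]
    · simp [h0]
    · exact hi
    · exact Continuous.integrable_of_hasCompactSupport (hf.continuous.smul hχ.continuous)
        (hc.smul_left (f := f))
    · exact fun x _ => (hf.differentiable one_ne_zero).differentiableAt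
    · exact fun x _ => (hχ.differentiable one_ne_zero).differentiableAt
  obtain ⟨i1, h1⟩ := key (fun _ => 1) a contDiff_const (by simp)
  obtain ⟨i2, h2⟩ := key (fun p => (a.1 * p.2.1 - a.2.1 * p.1) / 2) (0, 0, 1) (by fun_prop) (by
    intro p
    let L : H1 →L[ℝ] ℝ := (2 : ℝ)⁻¹ • (a.1 • ((ContinuousLinearMap.fst ℝ ℝ ℝ).comp
      (ContinuousLinearMap.snd ℝ ℝ (ℝ × ℝ))) - a.2.1 • ContinuousLinearMap.fst ℝ ℝ (ℝ × ℝ))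
    have hL : (fun p : H1 => (a.1 * p.2.1 - a.2.1 * p.1) / 2) = L := by
      funext p
      simp [L]
      ring
    rw [hL, L.fderiv]
    simp [L])
  have : ∀ p, fderiv ℝ χ p (leftInv a p) = (1 : ℝ) • fderiv ℝ χ p a +
      ((a.1 * p.2.1 - a.2.1 * p.1) / 2) • fderiv ℝ χ p (0, 0, 1) := by
    intro p
    rw [one_smul, ← map_smul, ← map_add]
    congr 1
    ext <;> simp [leftInv]
  simp only [this]
  rw [integral_add i1 i2, h1, h2, add_zero]

/-- The group law of `ℍ₁` for which the fields `leftInv a` are left-invariant. -/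
def gmul (p q : H1) : H1 :=
  (p.1 + q.1, p.2.1 + q.2.1, p.2.2 + q.2.2 + (q.1 * p.2.1 - q.2.1 * p.1) / 2)

theorem gmul_assoc (p q r : H1) : gmul (gmul p q) r = gmul p (gmul q r) := by
  ext <;> simp only [gmul] <;> ring

theorem continuous_gmul : Continuous fun x : H1 × H1 => gmul x.1 x.2 := by
  unfold gmul
  fun_prop

theorem contDiff_gmul_right (q : H1) {n : WithTop ℕ∞} : ContDiff ℝ n fun p => gmul p q := by
  unfold gmul
  fun_prop

theorem gmul_smul_smul (p a : H1) (s t : ℝ) :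
    gmul (gmul p (s • a)) (t • a) = gmul p ((s + t) • a) := by
  rw [gmul_assoc]
  congr 1
  ext <;> simp only [gmul, Prod.smul_fst, Prod.smul_snd, smul_eq_mul] <;> ring

theorem gmul_zero (p : H1) : gmul p 0 = p := by
  ext <;> simp [gmul]

theorem gmul_smul_neg (p a : H1) (s : ℝ) : gmul (gmul p (s • a)) ((-s) • a) = p := by
  rw [gmul_smul_smul, add_neg_cancel, zero_smul, gmul_zero]

/-- Right translation is triangular: each coordinate is shifted by an amount depending only on the
earlier ones. -/
theorem measurePreserving_gmul (q : H1) :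
    MeasurePreserving (fun p : H1 => gmul p q) volume volume := by
  have h1 : ∀ c : ℝ, MeasurePreserving (fun x : ℝ => x + c) volume volume :=
    fun c => measurePreserving_add_right volume c
  have h2 : ∀ x : ℝ, MeasurePreserving (fun y : ℝ × ℝ =>
      (y.1 + q.2.1, y.2 + (q.2.2 + (q.1 * y.1 - q.2.1 * x) / 2))) volume volume := by
    intro x
    refine (h1 q.2.1).skew_product (g := fun y z => z + (q.2.2 + (q.1 * y - q.2.1 * x) / 2)) ?_ ?_
    · apply Continuous.measurable
      simp only [Function.uncurry_def]
      fun_prop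
    · exact ae_of_all _ fun y => (h1 _).map_eq
  have h3 := (h1 q.1).skew_product (μc := (volume : Measure (ℝ × ℝ))) (μd := volume)
    (g := fun x y => (y.1 + q.2.1, y.2 + (q.2.2 + (q.1 * y.1 - q.2.1 * x) / 2))) (by
      apply Continuous.measurable
      simp only [Function.uncurry_def]
      fun_prop) (ae_of_all _ fun x => (h2 x).map_eq)
  have h : (fun p : H1 => gmul p q) = fun p => (p.1 + q.1, p.2.1 + q.2.1,
      p.2.2 + (q.2.2 + (q.1 * p.2.1 - q.2.1 * p.1) / 2)) := by
    funext p
    simp only [gmul, add_assoc]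
  rw [h]
  exact h3

open UnitaryGroup
open scoped ComplexConjugate

/-- `L²` of Haar measure on `ℍ₁`. -/
abbrev Flat : Type := Lp ℂ 2 (volume : Measure H1)

/-- Right translation by `q` on `L²`. -/
def transl (q : H1) : Flat →L[ℂ] Flat :=
  (Lp.compMeasurePreservingₗᵢ ℂ (fun p => gmul p q)
    (measurePreserving_gmul q)).toContinuousLinearMap

theorem coeFn_transl (q : H1) (F : Flat) : transl q F =ᵐ[volume] fun p => F (gmul p q) :=
  Lp.coeFn_compMeasurePreserving F (measurePreserving_gmul q)

theorem inner_transl_transl (q : H1) (F G : Flat) :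
    inner ℂ (transl q F) (transl q G) = inner ℂ F G :=
  LinearIsometry.inner_map_map (Lp.compMeasurePreservingₗᵢ ℂ (fun p => gmul p q)
    (measurePreserving_gmul q)) F G

theorem transl_transl (q q' : H1) (F : Flat) :
    transl q (transl q' F) = transl (gmul q q') F := by
  refine Lp.ext ?_
  filter_upwards [coeFn_transl q (transl q' F), coeFn_transl (gmul q q') F,
    (measurePreserving_gmul q).quasiMeasurePreserving.ae (coeFn_transl q' F)] with p h1 h2 h3
  rw [h1, h2, h3, gmul_assoc]

theorem transl_zero (F : Flat) : transl 0 F = F := by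
  refine Lp.ext ?_
  filter_upwards [coeFn_transl 0 F] with p h
  rw [h, gmul_zero]

theorem continuous_transl (F : Flat) : Continuous fun q => transl q F := by
  have hc : Continuous fun x : H1 × H1 => gmul x.2 x.1 := continuous_gmul.comp continuous_swap
  exact Continuous.compMeasurePreservingLp (f := fun _ : H1 => F)
    (g := fun q : H1 => (ContinuousMap.curry ⟨fun x : H1 × H1 => gmul x.2 x.1, hc⟩) q)
    continuous_const (ContinuousMap.continuous _) measurePreserving_gmul (by simp)

/-- The unitary group of right translations along the flow of `leftInv a`. -/
def flow (a : H1) (s : ℝ) : Flat →L[ℂ] Flat := transl (s • a)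

theorem isUnitaryGroup_flow (a : H1) : IsUnitaryGroup (flow a) := by
  have hadd : ∀ s t x, flow a (s + t) x = flow a s (flow a t x) := by
    intro s t x
    rw [flow, flow, flow, transl_transl]
    have := gmul_smul_smul 0 a s t
    have h0 : ∀ q, gmul 0 q = q := fun q => by ext <;> simp [gmul]
    rw [h0, h0] at this
    rw [this]
  have hzero : ∀ x, flow a 0 x = x := fun x => by rw [flow, zero_smul, transl_zero]
  refine ⟨hzero, hadd, fun s x y => ?_, fun x => ?_⟩
  · have : flow a s (flow a (-s) y) = y := by rw [← hadd, add_neg_cancel, hzero]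
    conv_lhs => rw [← this]
    exact inner_transl_transl _ _ _
  · exact (continuous_transl x).comp (continuous_id.smul continuous_const)

/-! ### Weak derivatives as generators of translation groups -/

/-- The weak form of `X F = G` for the left-invariant field `X` with value `a` at the origin. -/
def IsWeak (a : H1) (F G : Flat) : Prop :=
  ∀ ψ : H1 → ℂ, ContDiff ℝ 1 ψ → HasCompactSupport ψ →
    ∫ p, F p * fderiv ℝ ψ p (leftInv a p) = -∫ p, G p * ψ p

theorem hasDerivAt_gmul_neg (a p : H1) (r : ℝ) :
    HasDerivAt (fun r : ℝ => gmul p ((-r) • a)) (-leftInv a (gmul p ((-r) • a))) r := by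
  -- The orbits are straight lines, along which the field is constant.
  have h : (fun r : ℝ => gmul p ((-r) • a)) = fun r => p + (-r) • leftInv a p := by
    funext r
    ext <;> (simp only [gmul, leftInv, Prod.smul_fst, Prod.smul_snd, smul_eq_mul, Prod.fst_add,
      Prod.snd_add] <;> ring)
  have h' : leftInv a (gmul p ((-r) • a)) = leftInv a p := by
    ext <;> (simp only [gmul, leftInv, Prod.smul_fst, Prod.smul_snd, smul_eq_mul] <;> ring)
  rw [h, h', ← neg_one_smul ℝ (leftInv a p)]
  exact ((hasDerivAt_id r).neg.smul_const _).const_add p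

theorem hasCompactSupport_comp_gmul {ψ : H1 → ℂ} (hc : HasCompactSupport ψ) (a : H1) (s : ℝ) :
    HasCompactSupport fun p => ψ (gmul p (s • a)) := by
  have hK : IsCompact ((fun q => gmul q ((-s) • a)) '' tsupport ψ) :=
    IsCompact.image hc (contDiff_gmul_right _ (n := 0)).continuous
  refine HasCompactSupport.of_support_subset_isCompact hK fun p hp => ?_
  exact ⟨gmul p (s • a), subset_tsupport _ hp, gmul_smul_neg _ _ _⟩

theorem integrable_mul_test (F : Flat) {ψ : H1 → ℂ} (hψ : Continuous ψ)
    (hc : HasCompactSupport ψ) : Integrable fun p => F p * ψ p :=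
  MemLp.integrable_mul (p := 2) (q := 2) (Lp.memLp F) (hψ.memLp_of_hasCompactSupport hc)

theorem hasDerivAt_integral_comp_gmul_zero {a : H1} {F G : Flat} (h : IsWeak a F G) {ψ : H1 → ℂ}
    (hψ : ContDiff ℝ 1 ψ) (hc : HasCompactSupport ψ) :
    HasDerivAt (fun r : ℝ => ∫ p, F p * ψ (gmul p ((-r) • a))) (∫ p, G p * ψ p) 0 := by
  have hd : Continuous (fderiv ℝ ψ) := hψ.continuous_fderiv one_ne_zero
  have hX : Continuous (leftInv a) := (contDiff_leftInv a (n := 0)).continuous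
  have hDc : Continuous fun q => fderiv ℝ ψ q (leftInv a q) := hd.clm_apply hX
  have hDs : HasCompactSupport fun q => fderiv ℝ ψ q (leftInv a q) := by
    refine HasCompactSupport.of_support_subset_isCompact (hc.fderiv ℝ) fun p hp => ?_
    refine subset_tsupport _ fun h0 => hp ?_
    simp only [h0]
    rfl
  obtain ⟨M, hM⟩ := hDs.exists_bound_of_continuous hDc
  -- The region swept by the support under the flow for times $|r|\le1$, needed for one dominating
  -- function.
  let K : Set H1 := (fun x : ℝ × H1 => gmul x.2 (x.1 • a)) ''
    (Metric.closedBall 0 1 ×ˢ tsupport fun q => fderiv ℝ ψ q (leftInv a q))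
  have hK : IsCompact K := by
    refine ((isCompact_closedBall 0 1).prod hDs).image ?_
    exact continuous_gmul.comp (continuous_snd.prodMk (continuous_fst.smul continuous_const))
  have hFl : LocallyIntegrable F volume := (Lp.memLp F).locallyIntegrable (by norm_num)
  have key := hasDerivAt_integral_of_dominated_loc_of_deriv_le
    (μ := (volume : Measure H1)) (F := fun (r : ℝ) p => F p * ψ (gmul p ((-r) • a)))
    (F' := fun (r : ℝ) p => F p * -fderiv ℝ ψ (gmul p ((-r) • a)) (leftInv a (gmul p ((-r) • a))))
    (x₀ := 0) (s := Metric.ball 0 1) (bound := K.indicator fun p => ‖F p‖ * M)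
    (Metric.ball_mem_nhds _ one_pos) ?_ ?_ ?_ ?_ ?_ ?_
  · have := key.2
    simp only [neg_zero, zero_smul, gmul_zero, mul_neg] at this
    rwa [integral_neg, h ψ hψ hc, neg_neg] at this
  · refine Eventually.of_forall fun r => ?_
    exact (Lp.aestronglyMeasurable F).mul
      (hψ.continuous.comp (contDiff_gmul_right _ (n := 0)).continuous).aestronglyMeasurable
  · simp only [neg_zero, zero_smul, gmul_zero]
    exact integrable_mul_test F hψ.continuous hc
  · exact (Lp.aestronglyMeasurable F).mul
      (hDc.comp (contDiff_gmul_right _ (n := 0)).continuous).neg.aestronglyMeasurable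
  · refine ae_of_all _ fun p r hr => ?_
    by_cases hp : p ∈ K
    · rw [Set.indicator_of_mem hp, norm_mul, norm_neg]
      exact mul_le_mul_of_nonneg_left (hM _) (norm_nonneg _)
    · rw [Set.indicator_of_notMem hp]
      have : fderiv ℝ ψ (gmul p ((-r) • a)) (leftInv a (gmul p ((-r) • a))) = 0 := by
        by_contra hne
        refine hp ⟨(r, gmul p ((-r) • a)), ⟨Metric.ball_subset_closedBall hr, ?_⟩, ?_⟩
        · exact subset_tsupport (fun q => fderiv ℝ ψ q (leftInv a q)) hne
        · simpa using gmul_smul_neg p a (-r)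
      rw [this]
      simp
  · rw [integrable_indicator_iff hK.measurableSet]
    exact (hFl.integrableOn_isCompact hK).norm.mul_const M
  · refine ae_of_all _ fun p r _ => ?_
    have h1 := (hψ.differentiable one_ne_zero (gmul p ((-r) • a))).hasFDerivAt.comp_hasDerivAt r
      (hasDerivAt_gmul_neg a p r)
    have := h1.const_mul (F p)
    rw [map_neg] at this
    exact this

theorem hasDerivAt_integral_comp_gmul {a : H1} {F G : Flat} (h : IsWeak a F G) {ψ : H1 → ℂ}
    (hψ : ContDiff ℝ 1 ψ) (hc : HasCompactSupport ψ) (s : ℝ) :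
    HasDerivAt (fun r : ℝ => ∫ p, F p * ψ (gmul p ((-r) • a)))
      (∫ p, G p * ψ (gmul p ((-s) • a))) s := by
  have h0 := hasDerivAt_integral_comp_gmul_zero h (ψ := fun p => ψ (gmul p ((-s) • a)))
    (hψ.comp (contDiff_gmul_right _)) (hasCompactSupport_comp_gmul hc a (-s))
  rw [← sub_self s] at h0
  refine (h0.comp_sub_const s s).congr_of_eventuallyEq (Eventually.of_forall fun r => ?_)
  simp only [gmul_smul_smul]
  congr 1
  funext p
  congr 4
  ring

theorem integral_comp_gmul (a : H1) (F : Flat) (ψ : H1 → ℂ) (s : ℝ) :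
    ∫ p, F p * ψ (gmul p ((-s) • a)) = ∫ p, flow a s F p * ψ p := by
  have hmp := measurePreserving_gmul (s • a)
  have hme : MeasurableEmbedding fun p : H1 => gmul p (s • a) := by
    let e : H1 ≃ₜ H1 :=
      { toFun := fun p => gmul p (s • a)
        invFun := fun p => gmul p ((-s) • a)
        left_inv := fun p => gmul_smul_neg p a s
        right_inv := fun p => by simpa using gmul_smul_neg p a (-s)
        continuous_toFun := (contDiff_gmul_right _ (n := 0)).continuous
        continuous_invFun := (contDiff_gmul_right _ (n := 0)).continuous }
    exact e.measurableEmbedding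
  rw [← hmp.integral_comp hme]
  refine integral_congr_ae ?_
  filter_upwards [coeFn_transl (s • a) F] with p hp
  rw [gmul_smul_neg, flow, hp]

theorem norm_le_of_dense {H : Type*} [NormedAddCommGroup H] [InnerProductSpace ℂ H] {S : Set H}
    (hS : Dense S) {x : H} {C : ℝ} (hC : 0 ≤ C)
    (h : ∀ y ∈ S, ‖(inner ℂ y x : ℂ)‖ ≤ C * ‖y‖) : ‖x‖ ≤ C := by
  have hcl : IsClosed {y : H | ‖(inner ℂ y x : ℂ)‖ ≤ C * ‖y‖} :=
    isClosed_le (by fun_prop) (by fun_prop)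
  have hx : x ∈ {y : H | ‖(inner ℂ y x : ℂ)‖ ≤ C * ‖y‖} :=
    (closure_minimal h hcl) (hS x)
  have hx' : ‖(inner ℂ x x : ℂ)‖ ≤ C * ‖x‖ := hx
  rw [inner_self_eq_norm_sq_to_K, norm_pow] at hx'
  simp only [Complex.coe_algebraMap, Complex.norm_real, norm_norm] at hx'
  rcases (norm_nonneg x).eq_or_lt with h0 | h0
  · rwa [← h0]
  · nlinarith

/-- The weak derivative along a left-invariant field is the generator of its flow. -/
theorem IsWeak.hasGen {a : H1} {F G : Flat} (h : IsWeak a F G) : HasGen (flow a) F G := by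
  have hU := isUnitaryGroup_flow a
  have hmain : ∀ ε > 0, ∀ᶠ s : ℝ in 𝓝[≠] 0, ‖(s : ℂ)⁻¹ • (flow a s F - F) - G‖ ≤ ε := by
    intro ε hε
    have hcont : Tendsto (fun s => ‖flow a s G - G‖) (𝓝 0) (𝓝 0) := by
      have := (((hU.cont G).sub continuous_const).norm (E := Flat)).tendsto (x := (0 : ℝ))
        (f := fun s => ‖flow a s G - G‖)
      simpa [hU.zero] using this
    obtain ⟨δ, hδ, hball⟩ := Metric.eventually_nhds_iff_ball.1 (hcont.eventually_le_const hε)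
    filter_upwards [mem_nhdsWithin_of_mem_nhds (Metric.ball_mem_nhds 0 hδ),
      self_mem_nhdsWithin] with s hs hs0
    have hs0' : (s : ℂ) ≠ 0 := by exact_mod_cast hs0
    -- Against a fixed test $y$, the map $r\mapsto\langle y,a_rF-rG\rangle$ has derivative $\langle
    -- y,a_rG-G\rangle$, at most $\varepsilon\|y\|$ near 0 by strong continuity. The mean value
    -- inequality is uniform in $y$, and tests are dense.
    have hbound : ‖flow a s F - F - (s : ℂ) • G‖ ≤ ε * |s| := by
      refine norm_le_of_dense (Lp.dense_hasCompactSupport_contDiff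
        (μ := (volume : Measure H1)) (F := ℂ) (p := 2) (by simp)) (by positivity) ?_
      rintro y ⟨g, hyg, hgc, hgs⟩
      let ψ : H1 → ℂ := fun p => conj (g p)
      have hψ : ContDiff ℝ 1 ψ :=
        (Complex.conjCLE.contDiff.comp (hgs.of_le (by simp)) : ContDiff ℝ 1 _)
      have hψc : HasCompactSupport ψ := hgc.comp_left (g := fun z : ℂ => conj z) (map_zero _)
      have hin : ∀ x : Flat, inner ℂ y x = ∫ p, x p * ψ p := by
        intro x
        rw [L2.inner_def]
        refine integral_congr_ae ?_
        filter_upwards [hyg] with p hp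
        rw [hp]
        rfl
      have hder : ∀ r, HasDerivAt (fun r : ℝ => (inner ℂ y (flow a r F - (r : ℂ) • G) : ℂ))
          (inner ℂ y (flow a r G - G)) r := by
        intro r
        have h1 := hasDerivAt_integral_comp_gmul h hψ hψc r
        simp only [integral_comp_gmul, ← hin] at h1
        have h2 : HasDerivAt (fun r : ℝ => (r : ℂ) * inner ℂ y G) (1 * inner ℂ y G) r :=
          (HasDerivAt.ofReal_comp (hasDerivAt_id r)).mul_const _
        rw [one_mul] at h2
        simp only [inner_sub_right, inner_smul_right]
        exact h1.sub h2
      have hmv := (convex_ball (0 : ℝ) δ).norm_image_sub_le_of_norm_hasDerivWithin_le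
        (f := fun r : ℝ => (inner ℂ y (flow a r F - (r : ℂ) • G) : ℂ))
        (f' := fun r => (inner ℂ y (flow a r G - G) : ℂ)) (C := ‖y‖ * ε)
        (fun r _ => (hder r).hasDerivWithinAt)
        (fun r hr => (norm_inner_le_norm _ _).trans
          (mul_le_mul_of_nonneg_left (hball r hr) (norm_nonneg _)))
        (Metric.mem_ball_self hδ) hs
      simp only [hU.zero, Complex.ofReal_zero, zero_smul, sub_zero, ← inner_sub_right,
        Real.norm_eq_abs] at hmv
      rw [sub_right_comm, mul_right_comm, mul_comm ε]
      exact hmv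
    have heq : (s : ℂ)⁻¹ • (flow a s F - F) - G = (s : ℂ)⁻¹ • (flow a s F - F - (s : ℂ) • G) := by
      rw [smul_sub _ _ ((s : ℂ) • G), inv_smul_smul₀ hs0']
    rw [heq, norm_smul, norm_inv, Complex.norm_real, Real.norm_eq_abs,
      inv_mul_le_iff₀ (abs_pos.2 hs0), mul_comm]
    exact hbound
  rw [HasGen, Metric.tendsto_nhds]
  intro ε hε
  filter_upwards [hmain (ε / 2) (half_pos hε)] with s hs
  rw [dist_eq_norm]
  linarith

/-- The direction $(0,0,-1)$ reflects $[X_1,X_2]=-\partial_z$. -/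
theorem flow_comm (s t : ℝ) (F : Flat) :
    flow (1, 0, 0) s (flow (0, 1, 0) t F) =
      flow (0, 0, -1) (s * t) (flow (0, 1, 0) t (flow (1, 0, 0) s F)) := by
  simp only [flow, transl_transl]
  congr 2
  refine Prod.ext ?_ (Prod.ext ?_ ?_) <;> simp [gmul]
  ring

theorem flow_central (a : H1) (r s : ℝ) (F : Flat) :
    flow (0, 0, -1) r (flow a s F) = flow a s (flow (0, 0, -1) r F) := by
  simp only [flow, transl_transl]
  congr 2
  refine Prod.ext ?_ (Prod.ext ?_ ?_) <;> simp [gmul, add_comm]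

/-- The subelliptic estimate for the left-invariant fields in `L²`. -/
theorem sq_norm_le_of_isWeak {f v₁ v₂ w₁₁ w₁₂ w₂₁ w₂₂ : Flat}
    (hf1 : IsWeak (1, 0, 0) f v₁) (hf2 : IsWeak (0, 1, 0) f v₂) (h11 : IsWeak (1, 0, 0) v₁ w₁₁)
    (h12 : IsWeak (1, 0, 0) v₂ w₁₂) (h21 : IsWeak (0, 1, 0) v₁ w₂₁)
    (h22 : IsWeak (0, 1, 0) v₂ w₂₂) (hfc : IsWeak (0, 0, -1) f (w₁₂ - w₂₁)) :
    ‖f‖ ^ 2 + (‖v₁‖ ^ 2 + ‖v₂‖ ^ 2) + 2 * ‖w₁₂ - w₂₁‖ ^ 2 ≤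
      2 * ((‖w₁₁‖ ^ 2 + ‖w₁₂‖ ^ 2 + (‖w₂₁‖ ^ 2 + ‖w₂₂‖ ^ 2)) + ‖f‖ ^ 2) :=
  sq_norm_le_of_hasGen (isUnitaryGroup_flow _) (isUnitaryGroup_flow _) (isUnitaryGroup_flow _)
    flow_comm (flow_central _) (flow_central _) hf1.hasGen hf2.hasGen h11.hasGen h12.hasGen
    h21.hasGen h22.hasGen hfc.hasGen

/-! ### The weight -/

theorem interaction_eq (κ : ℝ) : interaction κ =
    fun p : H1 => ‖((p.1 ^ 2 + p.2.1 ^ 2 : ℝ) : ℂ) + ((4 * p.2.2 : ℝ) : ℂ) * Complex.I‖ ^ (κ / 2) := by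
  funext p
  have h0 : 0 ≤ (p.1 ^ 2 + p.2.1 ^ 2) ^ 2 + 16 * p.2.2 ^ 2 := by positivity
  rw [interaction, kaplanNorm, Complex.norm_add_mul_I, Real.sqrt_eq_rpow, ← Real.rpow_mul h0,
    ← Real.rpow_mul (by positivity)]
  congr 1 <;> ring

/-- Since $U=|x^2+y^2+4iz|^{\kappa/2}$, the condition $\kappa>2$ makes the exponent exceed 1, which
gives $C^1$ through the zero at the origin. -/
theorem contDiff_interaction {κ : ℝ} (hκ : 2 < κ) : ContDiff ℝ 1 (interaction κ) := by
  rw [interaction_eq]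
  refine ContDiff.norm_rpow ?_ (by linarith)
  have h1 : ContDiff ℝ 1 fun p : H1 => p.1 ^ 2 + p.2.1 ^ 2 := by fun_prop
  have h2 : ContDiff ℝ 1 fun p : H1 => 4 * p.2.2 := by fun_prop
  exact (Complex.ofRealCLM.contDiff.comp h1).add
    ((Complex.ofRealCLM.contDiff.comp h2).mul contDiff_const)

/-- The square root of the density of `mu κ`. -/
def halfWeight (κ : ℝ) (p : H1) : ℝ := Real.exp (-interaction κ p / 2)

theorem halfWeight_mul_self (κ : ℝ) (p : H1) :
    halfWeight κ p * halfWeight κ p = Real.exp (-interaction κ p) := by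
  rw [halfWeight, ← Real.exp_add]
  ring_nf

theorem halfWeight_pos (κ : ℝ) (p : H1) : 0 < halfWeight κ p := Real.exp_pos _

theorem contDiff_halfWeight {κ : ℝ} (hκ : 2 < κ) : ContDiff ℝ 1 (halfWeight κ) :=
  ((contDiff_interaction hκ).neg.div_const 2).exp

theorem fderiv_halfWeight_mul {κ : ℝ} (hκ : 2 < κ) {φ : H1 → ℂ} (hφ : ContDiff ℝ 1 φ)
    (X : H1 → H1) (p : H1) :
    fderiv ℝ (fun q => (halfWeight κ q : ℂ) * φ q) p (X p) =
      (halfWeight κ p : ℂ) * fieldV κ X φ p := by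
  have hU := ((contDiff_interaction hκ).differentiable one_ne_zero p).hasFDerivAt
  have hE : HasFDerivAt (halfWeight κ)
      (Real.exp (-interaction κ p / 2) • ((-(1 / 2 : ℝ)) • fderiv ℝ (interaction κ) p)) p := by
    have h1 := (hU.const_mul (-(1 / 2 : ℝ))).exp
    have h2 : (fun q => Real.exp (-(1 / 2 : ℝ) * interaction κ q)) = halfWeight κ := by
      funext q
      rw [halfWeight]
      ring_nf
    rw [h2] at h1
    convert! h1 using 2
    ring_nf
  have hE' := Complex.ofRealCLM.hasFDerivAt.comp p hE
  have h := hE'.mul ((hφ.differentiable one_ne_zero p).hasFDerivAt)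
  have h' : fderiv ℝ (fun q => (halfWeight κ q : ℂ) * φ q) p = _ := h.fderiv
  rw [h', fieldV]
  simp only [Function.comp_apply, Complex.ofRealCLM_apply, halfWeight,
    add_apply, smul_apply, ContinuousLinearMap.comp_apply,
    smul_eq_mul]
  push_cast
  ring

variable {κ : ℝ}

theorem continuous_fieldV (hκ : 2 < κ) {X : H1 → H1} (hX : Continuous X) {φ : H1 → ℂ}
    (hφ : ContDiff ℝ 1 φ) : Continuous (fieldV κ X φ) := by
  have h1 := (contDiff_interaction hκ).continuous_fderiv one_ne_zero
  have h2 := hφ.continuous_fderiv one_ne_zero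
  have h3 := hφ.continuous
  unfold fieldV
  have h4 : Continuous fun p => fderiv ℝ (interaction κ) p (X p) := h1.clm_apply hX
  have h5 : Continuous fun p => fderiv ℝ φ p (X p) := h2.clm_apply hX
  fun_prop

theorem hasCompactSupport_fieldV (X : H1 → H1) {φ : H1 → ℂ} (hc : HasCompactSupport φ) :
    HasCompactSupport (fieldV κ X φ) := by
  refine HasCompactSupport.of_support_subset_isCompact hc fun p hp => ?_
  by_contra hn
  refine hp ?_
  have h1 : fderiv ℝ φ p = 0 := by
    by_contra hne
    exact hn (tsupport_fderiv_subset ℝ (subset_tsupport (fderiv ℝ φ) hne))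
  simp [fieldV, h1, image_eq_zero_of_notMem_tsupport hn]

theorem measurable_weight (hκ : 2 < κ) :
    Measurable fun p => ENNReal.ofReal (Real.exp (-interaction κ p)) :=
  (Real.continuous_exp.comp (contDiff_interaction hκ).continuous.neg).measurable.ennreal_ofReal

theorem isFiniteMeasureOnCompacts_mu (hκ : 2 < κ) : IsFiniteMeasureOnCompacts (mu κ) := by
  have : IsLocallyFiniteMeasure (mu κ) := IsLocallyFiniteMeasure.withDensity_ofReal
    (Real.continuous_exp.comp (contDiff_interaction hκ).continuous.neg)
  infer_instance

theorem ac_mu (hκ : 2 < κ) : volume ≪ mu κ :=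
  withDensity_absolutelyContinuous' (measurable_weight hκ).aemeasurable
    (ae_of_all _ fun p => by simp [Real.exp_pos])

theorem integral_mu (hκ : 2 < κ) (g : H1 → ℂ) :
    ∫ p, g p ∂(mu κ) = ∫ p, ((halfWeight κ p : ℂ) * halfWeight κ p) * g p := by
  rw [mu, integral_withDensity_eq_integral_toReal_smul (measurable_weight hκ)
    (ae_of_all _ fun _ => ENNReal.ofReal_lt_top)]
  congr 1
  funext p
  rw [ENNReal.toReal_ofReal (Real.exp_pos _).le, ← halfWeight_mul_self, Complex.real_smul]
  push_cast
  ring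

theorem memLp_halfWeight_mul (hκ : 2 < κ) (f : L2 κ) :
    MemLp (fun p => (halfWeight κ p : ℂ) * f p) 2 volume := by
  have hm : AEStronglyMeasurable (fun p => (halfWeight κ p : ℂ) * f p) volume :=
    (Complex.continuous_ofReal.comp (contDiff_halfWeight hκ).continuous).aestronglyMeasurable.mul
      ((Lp.aestronglyMeasurable f).mono_ac (ac_mu hκ))
  rw [memLp_two_iff_integrable_sq_norm hm]
  have h := (memLp_two_iff_integrable_sq_norm (Lp.aestronglyMeasurable f)).1 (Lp.memLp f)
  replace h := (integrable_withDensity_iff_integrable_smul' (measurable_weight hκ)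
    (ae_of_all _ fun _ => ENNReal.ofReal_lt_top)).1 h
  refine h.congr (ae_of_all _ fun p => ?_)
  simp only
  rw [ENNReal.toReal_ofReal (Real.exp_pos _).le, ← halfWeight_mul_self, norm_mul,
    Complex.norm_real, Real.norm_eq_abs, abs_of_pos (halfWeight_pos κ p), smul_eq_mul]
  ring

/-- The unitary map `f ↦ e^{-U/2} f` from `L²(μ)` to `L²` of Haar measure. -/
def toFlat (hκ : 2 < κ) : L2 κ →ₗᵢ[ℂ] Flat :=
  LinearMap.isometryOfInner
    { toFun := fun f => (memLp_halfWeight_mul hκ f).toLp _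
      map_add' := fun f g => by
        rw [← MemLp.toLp_add]
        refine MemLp.toLp_congr _ _ ?_
        filter_upwards [(ac_mu hκ).ae_eq (Lp.coeFn_add f g)] with p hp
        simp only [hp, Pi.add_apply, mul_add]
      map_smul' := fun c f => by
        rw [RingHom.id_apply, ← MemLp.toLp_const_smul]
        refine MemLp.toLp_congr _ _ ?_
        filter_upwards [(ac_mu hκ).ae_eq (Lp.coeFn_smul c f)] with p hp
        simp only [hp, Pi.smul_apply, smul_eq_mul]
        ring }
    (fun f g => by
      rw [L2.inner_def, L2.inner_def, integral_mu hκ]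
      refine integral_congr_ae ?_
      filter_upwards [(memLp_halfWeight_mul hκ f).coeFn_toLp,
        (memLp_halfWeight_mul hκ g).coeFn_toLp] with p h1 h2
      simp only [LinearMap.coe_mk, AddHom.coe_mk, RCLike.inner_apply, h1, h2, map_mul,
        Complex.conj_ofReal]
      ring)

theorem coeFn_toFlat (hκ : 2 < κ) (f : L2 κ) :
    toFlat hκ f =ᵐ[volume] fun p => (halfWeight κ p : ℂ) * f p :=
  (memLp_halfWeight_mul hκ f).coeFn_toLp

theorem integral_mul_mu (hκ : 2 < κ) (f : L2 κ) (φ : H1 → ℂ) :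
    ∫ p, f p * φ p ∂(mu κ) = ∫ p, toFlat hκ f p * ((halfWeight κ p : ℂ) * φ p) := by
  rw [integral_mu hκ]
  refine integral_congr_ae ?_
  filter_upwards [coeFn_toFlat hκ f] with p hp
  rw [hp]
  ring

theorem integral_mul_fieldV_mu (hκ : 2 < κ) (f : L2 κ) (X : H1 → H1) {φ : H1 → ℂ}
    (hφ : ContDiff ℝ 1 φ) : ∫ p, f p * fieldV κ X φ p ∂(mu κ) =
      ∫ p, toFlat hκ f p * fderiv ℝ (fun q => (halfWeight κ q : ℂ) * φ q) p (X p) := by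
  rw [integral_mul_mu hκ]
  simp only [fderiv_halfWeight_mul hκ hφ]

theorem locallyIntegrable_flat (F : Flat) : LocallyIntegrable F volume :=
  (Lp.memLp F).locallyIntegrable (by norm_num)

theorem hasCompactSupport_field {φ : H1 → ℂ} (hc : HasCompactSupport φ) (X : H1 → H1) :
    HasCompactSupport fun p => fderiv ℝ φ p (X p) := by
  refine HasCompactSupport.of_support_subset_isCompact (hc.fderiv ℝ) fun p hp => ?_
  refine subset_tsupport _ fun h0 => hp ?_
  simp only [h0]
  rfl

/-- Conjugation by `e^{-U/2}` turns the operators `V` into the left-invariant fields. -/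
theorem hasV_iff_isWeak (hκ : 2 < κ) (a : H1) (f g : L2 κ) :
    HasV κ (leftInv a) f g ↔ IsWeak a (toFlat hκ f) (toFlat hκ g) := by
  have hX : Continuous (leftInv a) := (contDiff_leftInv a (n := 0)).continuous
  have hE := contDiff_halfWeight hκ
  have hEc : Continuous fun p => (halfWeight κ p : ℂ) :=
    Complex.continuous_ofReal.comp hE.continuous
  have hE' : ContDiff ℝ 1 fun p => (halfWeight κ p : ℂ) := Complex.ofRealCLM.contDiff.comp hE
  have hEne : ∀ p, (halfWeight κ p : ℂ) ≠ 0 := fun p => by exact_mod_cast (halfWeight_pos κ p).ne'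
  have hVc : ∀ φ : H1 → ℂ, ContDiff ℝ 1 φ → Continuous (fieldV κ (leftInv a) φ) :=
    fun φ hφ => continuous_fieldV hκ hX hφ
  constructor
  · intro h
    have hint : ∀ φ : H1 → ℂ, ContDiff ℝ 1 φ → HasCompactSupport φ →
        Integrable (fun p => toFlat hκ f p * ((halfWeight κ p : ℂ) * fieldV κ (leftInv a) φ p)) ∧
        Integrable (fun p => toFlat hκ g p * ((halfWeight κ p : ℂ) * φ p)) := fun φ hφ hc =>
      ⟨integrable_mul_test _ (hEc.mul (hVc φ hφ)) (hasCompactSupport_fieldV _ hc).mul_left,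
        integrable_mul_test _ (hEc.mul hφ.continuous) hc.mul_left⟩
    let D : H1 → ℂ := fun p =>
      ((1 / 2 * fderiv ℝ (interaction κ) p (leftInv a p) : ℝ) : ℂ)
    have hD : Continuous D := by
      have : Continuous fun p => fderiv ℝ (interaction κ) p (leftInv a p) :=
        ((contDiff_interaction hκ).continuous_fderiv one_ne_zero).clm_apply hX
      exact Complex.continuous_ofReal.comp (continuous_const.mul this)
    -- Separating the derivative of $\varphi$ from its multiples puts the identity in the form that
    -- passes to $C^1$ tests.
    have hcomb : ∀ (φ : H1 → ℂ) p,
        (halfWeight κ p : ℂ) * toFlat hκ f p * fderiv ℝ φ p (leftInv a p) +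
          (halfWeight κ p : ℂ) * (toFlat hκ g p - D p * toFlat hκ f p) * φ p =
        toFlat hκ f p * ((halfWeight κ p : ℂ) * fieldV κ (leftInv a) φ p) +
          toFlat hκ g p * ((halfWeight κ p : ℂ) * φ p) := by
      intro φ p
      simp only [fieldV, D]
      ring
    have hall := fun (φ : H1 → ℂ) (hφ : ContDiff ℝ 1 φ) (hc : HasCompactSupport φ) =>
      integral_eq_zero_of_smooth_tests
        (A := fun p => (halfWeight κ p : ℂ) * toFlat hκ f p)
        (B := fun p => (halfWeight κ p : ℂ) * (toFlat hκ g p - D p * toFlat hκ f p))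
        ((locallyIntegrable_flat _).continuous_mul hEc)
        (((locallyIntegrable_flat _).sub
          ((locallyIntegrable_flat _).continuous_mul hD)).continuous_mul hEc) hX
        (fun φ hφ hc => by
          have hφ1 : ContDiff ℝ 1 φ := hφ.of_le (by simp)
          simp only [hcomb]
          rw [integral_add (hint φ hφ1 hc).1 (hint φ hφ1 hc).2, ← integral_mul_mu,
            ← integral_mul_mu, h φ hφ hc, neg_add_cancel]) hφ hc
    intro ψ hψ hψc
    -- The test $e^{U/2}\psi$ cancels the weight. It is only $C^1$, which is why smooth tests do not
    -- suffice.
    have hφ : ContDiff ℝ 1 fun p => (halfWeight κ p : ℂ)⁻¹ * ψ p := (hE'.inv hEne).mul hψ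
    have hφc : HasCompactSupport fun p => (halfWeight κ p : ℂ)⁻¹ * ψ p := hψc.mul_left
    have h0 := hall _ hφ hφc
    simp only [hcomb, ← fderiv_halfWeight_mul hκ hφ, mul_inv_cancel_left₀ (hEne _)] at h0
    rw [integral_add] at h0
    · exact eq_neg_of_add_eq_zero_left h0
    · exact integrable_mul_test _ ((hψ.continuous_fderiv one_ne_zero).clm_apply hX)
        (hasCompactSupport_field hψc _)
    · exact integrable_mul_test _ hψ.continuous hψc
  · intro h φ hφ hc
    have hφ1 : ContDiff ℝ 1 φ := hφ.of_le (by simp)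
    rw [integral_mul_fieldV_mu hκ f _ hφ1, integral_mul_mu hκ]
    exact h _ (hE'.mul hφ1) hc.mul_left

/-! ### Lie brackets in the weak sense -/

theorem lieBracket_leftInv (a b : H1) :
    VectorField.lieBracket ℝ (leftInv a) (leftInv b) =
      leftInv (0, 0, b.1 * a.2.1 - b.2.1 * a.1) := by
  have hd : ∀ a p v : H1, fderiv ℝ (leftInv a) p v = (0, 0, (a.1 * v.2.1 - a.2.1 * v.1) / 2) := by
    intro a p v
    have h : HasDerivAt (fun t : ℝ => leftInv a (p + t • v))
        (0, 0, (a.1 * v.2.1 - a.2.1 * v.1) / 2) 0 := by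
      have : (fun t : ℝ => leftInv a (p + t • v)) = fun t : ℝ =>
          leftInv a p + t • ((0, 0, (a.1 * v.2.1 - a.2.1 * v.1) / 2) : H1) := by
        funext t
        refine Prod.ext ?_ (Prod.ext ?_ ?_) <;> simp [leftInv]
        ring
      rw [this]
      simpa using ((hasDerivAt_id (0 : ℝ)).smul_const
        ((0, 0, (a.1 * v.2.1 - a.2.1 * v.1) / 2) : H1)).const_add (leftInv a p)
    have hf := ((contDiff_leftInv a (n := 1)).differentiable one_ne_zero p).hasFDerivAt
    exact (hf.hasLineDerivAt v).unique h
  funext p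
  rw [VectorField.lieBracket_eq]
  simp only [hd]
  refine Prod.ext ?_ (Prod.ext ?_ ?_) <;> simp [leftInv]
  ring

theorem isWeak_lieBracket {a b : H1} {F V W P Q : Flat} (hV : IsWeak a F V) (hW : IsWeak b F W)
    (hP : IsWeak a W P) (hQ : IsWeak b V Q) :
    IsWeak (0, 0, b.1 * a.2.1 - b.2.1 * a.1) F (P - Q) := by
  set c : H1 := (0, 0, b.1 * a.2.1 - b.2.1 * a.1) with hc'
  have hX : ∀ a, Continuous (leftInv a) := fun a => (contDiff_leftInv a (n := 0)).continuous
  have hsub : ∀ ψ : H1 → ℂ, Continuous ψ → HasCompactSupport ψ →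
      ∫ p, (P - Q) p * ψ p = (∫ p, P p * ψ p) - ∫ p, Q p * ψ p := by
    intro ψ h1 h2
    rw [← integral_sub (integrable_mul_test _ h1 h2) (integrable_mul_test _ h1 h2)]
    refine integral_congr_ae ?_
    filter_upwards [Lp.coeFn_sub P Q] with p hp
    rw [hp, Pi.sub_apply, sub_mul]
  have hint : ∀ ψ : H1 → ℂ, ContDiff ℝ 1 ψ → HasCompactSupport ψ →
      Integrable (fun p => F p * fderiv ℝ ψ p (leftInv c p)) ∧
      Integrable (fun p => (P - Q) p * ψ p) := fun ψ h1 h2 =>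
    ⟨integrable_mul_test _ ((h1.continuous_fderiv one_ne_zero).clm_apply (hX c))
      (hasCompactSupport_field h2 _), integrable_mul_test _ h1.continuous h2⟩
  intro ψ hψ hψc
  -- The bracket is expanded on smooth $\varphi$, so that $X_a\varphi$ and $X_b\varphi$ are still
  -- $C^1$ tests; $C^1$ tests follow by mollification.
  have key := integral_eq_zero_of_smooth_tests (A := F) (B := (P - Q : Flat))
    (X := leftInv c) (locallyIntegrable_flat _) (locallyIntegrable_flat _) (hX c) ?_ hψ hψc
  · rw [integral_add (hint ψ hψ hψc).1 (hint ψ hψ hψc).2] at key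
    exact eq_neg_of_add_eq_zero_left key
  · intro φ hφ hφc
    have hφ1 : ContDiff ℝ 1 φ := hφ.of_le (by simp)
    have hXφ : ∀ a, ContDiff ℝ 1 fun p => fderiv ℝ φ p (leftInv a p) := fun a =>
      (hφ.fderiv_right (m := 1) (by norm_cast)).clm_apply (contDiff_leftInv a)
    have hXφc : ∀ a, HasCompactSupport fun p => fderiv ℝ φ p (leftInv a p) := fun a =>
      hasCompactSupport_field hφc _
    have hbr : ∀ p, fderiv ℝ φ p (leftInv c p) =
        fderiv ℝ (fun q => fderiv ℝ φ q (leftInv b q)) p (leftInv a p) -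
          fderiv ℝ (fun q => fderiv ℝ φ q (leftInv a q)) p (leftInv b p) := by
      intro p
      rw [hc', ← lieBracket_leftInv]
      exact VectorField.fderiv_apply_lieBracket (n := 2) (hφ.of_le (by norm_cast)).contDiffAt
        (by simp) ((contDiff_leftInv b (n := 1)).differentiable one_ne_zero p)
        ((contDiff_leftInv a (n := 1)).differentiable one_ne_zero p)
    rw [integral_add (hint φ hφ1 hφc).1 (hint φ hφ1 hφc).2, hsub φ hφ1.continuous hφc]
    simp only [hbr, mul_sub]
    rw [integral_sub, hV _ (hXφ b) (hXφc b), hW _ (hXφ a) (hXφc a), hP φ hφ1 hφc, hQ φ hφ1 hφc]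
    · ring
    · exact integrable_mul_test _ (((hXφ b).continuous_fderiv one_ne_zero).clm_apply (hX a))
        (hasCompactSupport_field (hXφc b) _)
    · exact integrable_mul_test _ (((hXφ a).continuous_fderiv one_ne_zero).clm_apply (hX b))
        (hasCompactSupport_field (hXφc a) _)

/-- The values at the origin of the generating fields. -/
def genDir : Fin 2 → H1 := ![(1, 0, 0), (0, 1, 0)]

/-- The values at the origin of the fields `field α`. -/
def fieldDir : Fin 2 ⊕ (Fin 2 × Fin 2) → H1
  | Sum.inl j => genDir j
  | Sum.inr (j, l) =>
    (0, 0, (genDir l).1 * (genDir j).2.1 - (genDir l).2.1 * (genDir j).1)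

theorem gen_eq (j : Fin 2) : gen j = leftInv (genDir j) := by
  fin_cases j
  · funext p
    refine Prod.ext ?_ (Prod.ext ?_ ?_) <;> simp [leftInv, gen, genDir]
  · funext p
    refine Prod.ext ?_ (Prod.ext ?_ ?_) <;> simp [leftInv, gen, genDir]

theorem field_eq (α : Fin 2 ⊕ (Fin 2 × Fin 2)) : field α = leftInv (fieldDir α) := by
  rcases α with j | ⟨j, l⟩
  · exact gen_eq j
  · rw [field, gen_eq, gen_eq, lieBracket_leftInv, fieldDir]

/-! ### Closedness of weak derivatives and density of their domains -/

theorem exists_pairing {χ : H1 → ℂ} (hχ : Continuous χ) (hc : HasCompactSupport χ) :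
    ∃ L : Flat →L[ℂ] ℂ, ∀ F : Flat, L F = ∫ p, F p * χ p := by
  have hm : MemLp (fun p => conj (χ p)) 2 (volume : Measure H1) :=
    (Complex.continuous_conj.comp hχ).memLp_of_hasCompactSupport
      (hc.comp_left (g := fun z : ℂ => conj z) (map_zero _))
  refine ⟨innerSL ℂ (hm.toLp _), fun F => ?_⟩
  rw [innerSL_apply_apply, L2.inner_def]
  refine integral_congr_ae ?_
  filter_upwards [hm.coeFn_toLp] with p hp
  rw [hp, RCLike.inner_apply, Complex.conj_conj]

/-- Each test cuts out the kernel of a continuous functional, so the weak graph is a closed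
subspace. -/
theorem exists_isWeak_functional (a : H1) {ψ : H1 → ℂ} (hψ : ContDiff ℝ 1 ψ)
    (hc : HasCompactSupport ψ) : ∃ L : Flat × Flat →L[ℂ] ℂ, ∀ F G : Flat,
      L (F, G) = (∫ p, F p * fderiv ℝ ψ p (leftInv a p)) + ∫ p, G p * ψ p := by
  obtain ⟨L₁, h₁⟩ := exists_pairing ((hψ.continuous_fderiv one_ne_zero).clm_apply
    (contDiff_leftInv a (n := 0)).continuous) (hasCompactSupport_field hc (leftInv a))
  obtain ⟨L₂, h₂⟩ := exists_pairing hψ.continuous hc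
  exact ⟨L₁.coprod L₂, fun F G => by rw [ContinuousLinearMap.coprod_apply, h₁, h₂]⟩

/-- The graph of the weak derivative along `leftInv a`. -/
def weakGraph (a : H1) : Submodule ℂ (Flat × Flat) where
  carrier := {x | IsWeak a x.1 x.2}
  add_mem' := by
    rintro ⟨F, G⟩ ⟨F', G'⟩ h h' ψ hψ hc
    obtain ⟨L, hL⟩ := exists_isWeak_functional a hψ hc
    have h1 : L (F, G) = 0 := by rw [hL]; exact add_eq_zero_iff_eq_neg.2 (h ψ hψ hc)
    have h2 : L (F', G') = 0 := by rw [hL]; exact add_eq_zero_iff_eq_neg.2 (h' ψ hψ hc)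
    refine add_eq_zero_iff_eq_neg.1 ?_
    rw [← hL]
    exact (L.map_add (F, G) (F', G')).trans (by rw [h1, h2, add_zero])
  zero_mem' := by
    intro ψ hψ hc
    obtain ⟨L, hL⟩ := exists_isWeak_functional a hψ hc
    refine add_eq_zero_iff_eq_neg.1 ?_
    rw [← hL]
    exact L.map_zero
  smul_mem' := by
    rintro c ⟨F, G⟩ h ψ hψ hc
    obtain ⟨L, hL⟩ := exists_isWeak_functional a hψ hc
    have h1 : L (F, G) = 0 := by rw [hL]; exact add_eq_zero_iff_eq_neg.2 (h ψ hψ hc)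
    refine add_eq_zero_iff_eq_neg.1 ?_
    rw [← hL]
    exact (L.map_smul c (F, G)).trans (by rw [h1, smul_zero])

theorem isClosed_weakGraph (a : H1) : IsClosed (weakGraph a : Set (Flat × Flat)) := by
  rw [← isSeqClosed_iff_isClosed]
  rintro u ⟨F, G⟩ hu hlim ψ hψ hc
  obtain ⟨L, hL⟩ := exists_isWeak_functional a hψ hc
  refine add_eq_zero_iff_eq_neg.1 ?_
  rw [← hL]
  refine tendsto_nhds_unique ((L.continuous.tendsto _).comp hlim) ?_
  refine tendsto_const_nhds.congr fun n => ?_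
  rw [Function.comp_apply, ← Prod.mk.eta (p := u n), hL]
  exact (add_eq_zero_iff_eq_neg.2 (hu n ψ hψ hc)).symm

/-- Uniqueness of weak derivatives, needed for the form domain to embed injectively into $L^2(\mu)$.
-/
theorem IsWeak.eq_zero {a : H1} {G : Flat} (h : IsWeak a 0 G) : G = 0 := by
  refine tendsto_nhds_unique h.hasGen ?_
  simp only [map_zero, sub_zero, smul_zero]
  exact tendsto_const_nhds

theorem isWeak_of_contDiff (a : H1) {ψ : H1 → ℂ} (hψ : ContDiff ℝ 1 ψ) (hc : HasCompactSupport ψ)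
    {F G : Flat} (hF : F =ᵐ[volume] ψ) (hG : G =ᵐ[volume] fun p => fderiv ℝ ψ p (leftInv a p)) :
    IsWeak a F G := by
  intro χ hχ hχc
  have hX : Continuous (leftInv a) := (contDiff_leftInv a (n := 0)).continuous
  have h0 := integral_fderiv_leftInv a (hψ.mul hχ) hc.mul_right
  have hprod : ∀ p, fderiv ℝ (fun q => ψ q * χ q) p (leftInv a p) =
      ψ p * fderiv ℝ χ p (leftInv a p) + fderiv ℝ ψ p (leftInv a p) * χ p := by
    intro p
    rw [fderiv_fun_mul (hψ.differentiable one_ne_zero p) (hχ.differentiable one_ne_zero p)]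
    simp only [add_apply, smul_apply, smul_eq_mul]
    ring
  simp only [hprod] at h0
  rw [integral_add] at h0
  · have e1 : ∫ p, F p * fderiv ℝ χ p (leftInv a p) = ∫ p, ψ p * fderiv ℝ χ p (leftInv a p) := by
      refine integral_congr_ae ?_
      filter_upwards [hF] with p hp
      rw [hp]
    have e2 : ∫ p, G p * χ p = ∫ p, fderiv ℝ ψ p (leftInv a p) * χ p := by
      refine integral_congr_ae ?_
      filter_upwards [hG] with p hp
      rw [hp]
    rw [e1, e2]
    exact eq_neg_of_add_eq_zero_left h0
  · exact Continuous.integrable_of_hasCompactSupport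
      (hψ.continuous.mul ((hχ.continuous_fderiv one_ne_zero).clm_apply hX)) hc.mul_right
  · exact Continuous.integrable_of_hasCompactSupport
      (((hψ.continuous_fderiv one_ne_zero).clm_apply hX).mul hχ.continuous) hχc.mul_left

variable {κ : ℝ}

theorem exists_hasV_of_smooth (hκ : 2 < κ) {φ : H1 → ℂ} (hφ : ContDiff ℝ ∞ φ)
    (hc : HasCompactSupport φ) {f : L2 κ} (hf : f =ᵐ[mu κ] φ) (a : H1) :
    ∃ g : L2 κ, HasV κ (leftInv a) f g := by
  have := isFiniteMeasureOnCompacts_mu hκ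
  have hφ1 : ContDiff ℝ 1 φ := hφ.of_le (by simp)
  have hm : MemLp (fieldV κ (leftInv a) φ) 2 (mu κ) :=
    (continuous_fieldV hκ (contDiff_leftInv a (n := 0)).continuous hφ1).memLp_of_hasCompactSupport
      (hasCompactSupport_fieldV _ hc)
  refine ⟨hm.toLp _, (hasV_iff_isWeak hκ a _ _).2 ?_⟩
  have hE : ContDiff ℝ 1 fun p => (halfWeight κ p : ℂ) :=
    Complex.ofRealCLM.contDiff.comp (contDiff_halfWeight hκ)
  refine isWeak_of_contDiff a (hE.mul hφ1) hc.mul_left ?_ ?_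
  · filter_upwards [coeFn_toFlat hκ f, (ac_mu hκ).ae_eq hf] with p h1 h2
    rw [h1, h2]
  · filter_upwards [coeFn_toFlat hκ (hm.toLp _), (ac_mu hκ).ae_eq hm.coeFn_toLp] with p h1 h2
    rw [h1, h2, fderiv_halfWeight_mul hκ hφ1]

/-! ### The form domain and the operator $1+\Theta$ -/

/-- The ambient Hilbert space of the form of `1 + Θ`. -/
abbrev FormAmbient (κ : ℝ) : Type :=
  PiLp 2 fun _ : Option (Fin 2 ⊕ (Fin 2 × Fin 2)) => L2 κ

/-- The form domain of `Θ`, with the form norm, as the space of all `(f, (V_α f)_α)`. -/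
def formSpace (hκ : 2 < κ) : Submodule ℂ (FormAmbient κ) :=
  ⨅ α, (weakGraph (fieldDir α)).comap
    (((toFlat hκ).toLinearMap ∘ₗ (PiLp.proj 2 _ none : FormAmbient κ →L[ℂ] L2 κ).toLinearMap).prod
      ((toFlat hκ).toLinearMap ∘ₗ (PiLp.proj 2 _ (some α) : FormAmbient κ →L[ℂ] L2 κ).toLinearMap))

theorem mem_formSpace (hκ : 2 < κ) (k : FormAmbient κ) :
    k ∈ formSpace hκ ↔ ∀ α, HasV κ (field α) (k none) (k (some α)) := by
  simp only [formSpace, Submodule.mem_iInf, Submodule.mem_comap, field_eq, hasV_iff_isWeak hκ]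
  rfl

theorem isClosed_formSpace (hκ : 2 < κ) : IsClosed (formSpace hκ : Set (FormAmbient κ)) := by
  rw [formSpace, Submodule.coe_iInf]
  refine isClosed_iInter fun α => (isClosed_weakGraph _).preimage ?_
  exact ((toFlat hκ).continuous.comp (PiLp.proj 2 _ none : FormAmbient κ →L[ℂ] L2 κ).continuous).prodMk
    ((toFlat hκ).continuous.comp (PiLp.proj 2 _ (some α) : FormAmbient κ →L[ℂ] L2 κ).continuous)

/-- The inclusion of the form domain of `Θ` into `L²(μ)`. -/
def formIncl (hκ : 2 < κ) : formSpace hκ →L[ℂ] L2 κ :=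
  (PiLp.proj 2 _ none : FormAmbient κ →L[ℂ] L2 κ).comp (formSpace hκ).subtypeL

theorem formIncl_apply (hκ : 2 < κ) (k : formSpace hκ) : formIncl hκ k = (k : FormAmbient κ) none :=
  rfl

theorem formIncl_injective (hκ : 2 < κ) : Function.Injective (formIncl hκ) := by
  rw [injective_iff_map_eq_zero]
  intro k hk
  rw [formIncl_apply] at hk
  refine Subtype.ext (PiLp.ext fun o => ?_)
  rcases o with _ | α
  · exact hk
  · have h := (mem_formSpace hκ _).1 k.2 α
    rw [field_eq, hasV_iff_isWeak hκ, hk, map_zero] at h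
    exact (map_eq_zero_iff _ (toFlat hκ).injective).1 h.eq_zero

/-- The element of the form space given by `f` and its weak derivatives. -/
def formMk (hκ : 2 < κ) (f : L2 κ) (v : Fin 2 ⊕ (Fin 2 × Fin 2) → L2 κ)
    (h : ∀ α, HasV κ (field α) f (v α)) : formSpace hκ :=
  ⟨WithLp.toLp 2 fun o => o.elim f v, (mem_formSpace hκ _).2 h⟩

theorem denseRange_formIncl (hκ : 2 < κ) : DenseRange (formIncl hκ) := by
  have := isFiniteMeasureOnCompacts_mu hκ
  refine (Lp.dense_hasCompactSupport_contDiff (μ := mu κ) (F := ℂ) (p := 2) (by simp)).mono ?_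
  rintro f ⟨φ, hf, hc, hφ⟩
  have h : ∀ α, ∃ g : L2 κ, HasV κ (field α) f g := fun α => by
    rw [field_eq]
    exact exists_hasV_of_smooth hκ hφ hc hf _
  choose v hv using h
  exact ⟨formMk hκ f v hv, rfl⟩

instance completeSpace_formSpace (hκ : 2 < κ) : CompleteSpace (formSpace hκ) :=
  (isClosed_formSpace hκ).completeSpace_coe

/-- The form definition of $(1+\Theta)f=f+h$ says that $\langle f+h,Jk\rangle$ is the form inner
product of $f$ with $k$ for all $k$. This characterises $J^*(f+h)$ as the element over $f$. -/
theorem hasTheta_iff (hκ : 2 < κ) (f h : L2 κ) :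
    HasTheta κ f h ↔ formIncl hκ ((formIncl hκ).adjoint (f + h)) = f := by
  have hinner : ∀ k k' : formSpace hκ, inner ℂ k k' =
      inner ℂ ((k : FormAmbient κ) none) ((k' : FormAmbient κ) none) +
        ∑ α, inner ℂ ((k : FormAmbient κ) (some α)) ((k' : FormAmbient κ) (some α)) := by
    intro k k'
    rw [Submodule.coe_inner, PiLp.inner_apply, Fintype.sum_option]
  constructor
  · rintro ⟨v, hv, hform⟩
    have : (formIncl hκ).adjoint (f + h) = formMk hκ f v hv := by
      refine ext_inner_right ℂ fun k => ?_
      rw [ContinuousLinearMap.adjoint_inner_left, hinner, inner_add_left, formIncl_apply,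
        hform _ (fun α => (k : FormAmbient κ) (some α)) ((mem_formSpace hκ _).1 k.2)]
      rfl
    rw [this]
    rfl
  · intro heq
    set k := (formIncl hκ).adjoint (f + h) with hk
    have hmem := (mem_formSpace hκ _).1 k.2
    rw [← formIncl_apply, heq] at hmem
    refine ⟨fun α => (k : FormAmbient κ) (some α), hmem, fun g u hu => ?_⟩
    have h1 : inner ℂ k (formMk hκ g u hu) = inner ℂ (f + h) g := by
      rw [hk, ContinuousLinearMap.adjoint_inner_left]
      rfl
    rw [hinner, ← formIncl_apply, heq, inner_add_left] at h1
    exact (add_left_cancel h1).symm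

theorem isLambdaOne_iff (hκ : 2 < κ) (S : L2 κ →ₗ.[ℂ] L2 κ) :
    IsLambdaOne κ S ↔ IsSelfAdjoint S ∧ (∀ f : S.domain, 0 ≤ (inner ℂ (S f) (f : L2 κ)).re) ∧
      ∀ x y, (∃ (hx : x ∈ S.domain) (hSx : S ⟨x, hx⟩ ∈ S.domain),
        S ⟨S ⟨x, hx⟩, hSx⟩ = y) ↔ formIncl hκ ((formIncl hκ).adjoint y) = x := by
  constructor
  · rintro ⟨h1, h2, h3⟩
    refine ⟨h1, h2, fun x y => ?_⟩
    have := h3 x (y - x)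
    rwa [hasTheta_iff hκ, add_sub_cancel] at this
  · rintro ⟨h1, h2, h3⟩
    exact ⟨h1, h2, fun f h => by rw [hasTheta_iff hκ]; exact h3 f (f + h)⟩

/-- All first order data of a function with second order horizontal weak derivatives. -/
theorem hasV_field_of_hasV_gen (hκ : 2 < κ) {f : L2 κ} {v : Fin 2 → L2 κ}
    {w : Fin 2 → Fin 2 → L2 κ} (hv : ∀ l, HasV κ (gen l) f (v l))
    (hw : ∀ j l, HasV κ (gen j) (v l) (w j l)) (α : Fin 2 ⊕ (Fin 2 × Fin 2)) :
    HasV κ (field α) f (Sum.elim v (fun x => w x.1 x.2 - w x.2 x.1) α) := by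
  rcases α with j | ⟨j, l⟩
  · exact hv j
  · simp only [gen_eq, hasV_iff_isWeak hκ] at hv hw
    rw [field_eq, hasV_iff_isWeak hκ, Sum.elim_inr, map_sub]
    exact isWeak_lieBracket (hv j) (hv l) (hw j l) (hw l j)

theorem norm_sq_formMk_le (hκ : 2 < κ) {f : L2 κ} {v : Fin 2 → L2 κ}
    {w : Fin 2 → Fin 2 → L2 κ} (hv : ∀ l, HasV κ (gen l) f (v l))
    (hw : ∀ j l, HasV κ (gen j) (v l) (w j l)) :
    ‖formMk hκ f _ (hasV_field_of_hasV_gen hκ hv hw)‖ ^ 2 ≤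
      2 * ((∑ j, ∑ l, ‖w j l‖ ^ 2) + ‖f‖ ^ 2) := by
  have hV := hasV_field_of_hasV_gen hκ hv hw (Sum.inr (0, 1))
  simp only [gen_eq, hasV_iff_isWeak hκ] at hv hw
  rw [field_eq, hasV_iff_isWeak hκ, Sum.elim_inr, map_sub] at hV
  have hdir : fieldDir (Sum.inr (0, 1)) = (0, 0, -1) := by simp [fieldDir, genDir]
  rw [hdir] at hV
  have key := sq_norm_le_of_isWeak (hv 0) (hv 1) (hw 0 0) (hw 0 1) (hw 1 0) (hw 1 1) hV
  rw [← map_sub] at key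
  simp only [LinearIsometry.norm_map] at key
  have hn : ‖formMk hκ f _ (hasV_field_of_hasV_gen hκ (v := v) (w := w)
      (by simpa only [gen_eq, hasV_iff_isWeak hκ] using hv)
      (by simpa only [gen_eq, hasV_iff_isWeak hκ] using hw))‖ ^ 2 =
      ‖f‖ ^ 2 + (‖v 0‖ ^ 2 + ‖v 1‖ ^ 2) + 2 * ‖w 0 1 - w 1 0‖ ^ 2 := by
    -- The pairs $(1,2)$ and $(2,1)$ contribute equally, whence the factor 2; the diagonal
    -- commutators vanish.
    rw [Submodule.coe_norm, PiLp.norm_sq_eq_of_L2, Fintype.sum_option, Fintype.sum_sum_type,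
      Fintype.sum_prod_type]
    simp only [formMk, Fin.sum_univ_two, Option.elim, Sum.elim_inl, Sum.elim_inr, sub_self,
      norm_zero]
    rw [norm_sub_rev (w 1 0)]
    ring
  rw [hn]
  simpa only [Fin.sum_univ_two] using key

end Heisenberg
end

theorem mainTheorem9 (κ : ℝ) (hκ : 2 < κ) :
    ∃ Λ₁ : Heisenberg.L2 κ →ₗ.[ℂ] Heisenberg.L2 κ,
      Heisenberg.IsLambdaOne κ Λ₁ ∧
      (∀ S : Heisenberg.L2 κ →ₗ.[ℂ] Heisenberg.L2 κ, Heisenberg.IsLambdaOne κ S → S = Λ₁) ∧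
      ∀ (f : Heisenberg.L2 κ) (v : Fin 2 → Heisenberg.L2 κ)
        (w : Fin 2 → Fin 2 → Heisenberg.L2 κ),
        (∀ l, Heisenberg.HasV κ (Heisenberg.gen l) f (v l)) →
        (∀ j l, Heisenberg.HasV κ (Heisenberg.gen j) (v l) (w j l)) →
        ∃ hf : f ∈ Λ₁.domain,
          ‖Λ₁ ⟨f, hf⟩‖ ^ 2 ≤ 2 * ((∑ j, ∑ l, ‖w j l‖ ^ 2) + ‖f‖ ^ 2) := by
  obtain ⟨Λ, h1, h2, h3⟩ := HilbertForm.exists_unique_sqrt (Heisenberg.formIncl hκ)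
    (Heisenberg.formIncl_injective hκ) (Heisenberg.denseRange_formIncl hκ)
  refine ⟨Λ, (Heisenberg.isLambdaOne_iff hκ Λ).2 h1, fun S hS => ?_, fun f v w hv hw => ?_⟩
  · obtain ⟨s1, s2, s3⟩ := (Heisenberg.isLambdaOne_iff hκ S).1 hS
    exact h2 S s1 s2 s3
  · obtain ⟨hk, hn⟩ := h3 (Heisenberg.formMk hκ f _ (Heisenberg.hasV_field_of_hasV_gen hκ hv hw))
    refine ⟨hk, ?_⟩
    have := Heisenberg.norm_sq_formMk_le hκ hv hw
    rw [← hn] at this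
    exact this
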